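/- Let $d\ge 1$ and let $G$ be a finite group with a linear action on $\mathbb{C}^d$; write $g$ also for the matrix by which $g\in G$ acts. There is a $G$-invariant Hermitian inner product on $\mathbb{C}^d$. Fix any such inner product (when the action is unitary, for instance the standard one), and let $\Delta=\sum_k\partial_{u_k}\overline{\partial}_{u_k}$ for linear coordinates $u$ on $\mathbb{C}^d$ that are orthonormal for it. For $p,q\ge 0$ let $H(p,q)$ be the space of functions on $\mathbb{C}^d$ that are polynomials in $z$ and $\overline z$, homogeneous of degree $p$ in $z$ and of degree $q$ in $\overline z$, and satisfy $\Delta f=0$. Let $H(p,q)^G$ be the subspace of those $f\in H(p,q)$ with $f(g^{-1}v)=f(v)$ for all $g\in G$, $v\in\mathbb{C}^d$. It is finite-dimensional, and $$\dim H(p,q)^G=\dim H(q,p)^G=\frac{1}{p!\,q!}\frac1{|G|}\sum_{g\in G}\frac{\partial^p}{\partial x^p}\frac{\partial^q}{\partial y^q}\,\frac{1-xy}{f_g(x)f_{g^{-1}}(y)}\Big|_{(x,y)=(0,0)},$$ where $f_g(x)=\det(I-xg)$. Moreover $f_g(0)=1$, $f_g^{(k)}(0)=(-1)^k\,k!\,\mathrm{tr}(\Lambda^k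 g)$ for $1\le k\le d$, and $f_g^{(k)}(0)=0$ for $k>d$. In particular, $$\dim H(1,0)^G=\frac1{|G|}\sum_{g\in G}\mathrm{tr}(g),\qquad \dim H(2,0)^G=\frac12\frac1{|G|}\sum_{g\in G}\bigl\{\mathrm{tr}(g)^2+\mathrm{tr}(g^2)\bigr\},$$ $$\dim H(3,0)^G=\frac16\frac1{|G|}\sum_{g\in G}\bigl\{\mathrm{tr}(g)^3+2\,\mathrm{tr}(g^3)+3\,\mathrm{tr}(g)\,\mathrm{tr}(g^2)\bigr\},$$ $$\dim H(1,1)^G=\frac1{|G|}\sum_{g\in G}\bigl\{\mathrm{tr}(g)\,\mathrm{tr}(g^{-1})-1\bigr\},$$ $$\dim H(2,1)^G=\frac12\frac1{|G|}\sum_{g\in G}\bigl\{\mathrm{tr}(g)^2\,\mathrm{tr}(g^{-1})+\mathrm{tr}(g^2)\,\mathrm{tr}(g^{-1})-2\,\mathrm{tr}(g)\bigr\}.$$ Finally, each summand in the sums above depends only on the eigenvalues of $g$ (with multiplicity), and each sum can be taken over conjugacy classes: for such a summand $t$, and any choice of representatives $g_C$ of the conjugacy classes $C$ of $G$, $\sum_{g\in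 G}t(g)=\sum_{C}|C|\,t(g_C)$. -/

import Mathlib

open scoped Nat ComplexOrder

namespace HarmonicMolien

noncomputable section

/-- Polynomials in the variables `z_1, …, z_d` (the variables `Sum.inl j`) and
`z̄_1, …, z̄_d` (the variables `Sum.inr j`). -/
abbrev BiPoly (d : ℕ) : Type := MvPolynomial (Fin d ⊕ Fin d) ℂ

/-- The function `z ↦ P(z, z̄)` on `ℂ^d` given by a polynomial in `z` and `z̄`. -/
def toFun (d : ℕ) : BiPoly d →ₗ[ℂ] ((Fin d → ℂ) → ℂ) where
  toFun P := fun z => MvPolynomial.eval (Sum.elim z (fun j => star (z j))) P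
  map_add' P Q := by ext z; simp
  map_smul' c P := by ext z; simp

/-- The variables `z_j` have bidegree `(1,0)`, the variables `z̄_j` have bidegree `(0,1)`. -/
def bidegree (d : ℕ) : Fin d ⊕ Fin d → ℕ × ℕ := Sum.elim (fun _ => (1, 0)) (fun _ => (0, 1))

/-- The polynomials which are homogeneous of degree `p` in `z` and of degree `q` in `z̄`. -/
def biHom (d p q : ℕ) : Submodule ℂ (BiPoly d) :=
  MvPolynomial.weightedHomogeneousSubmodule ℂ (bidegree d) (p, q)

/-- The complex Laplacian of the Hermitian inner product `⟨v, w⟩ = v* A w` on `ℂ^d`, that is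
`∑_k ∂_{u_k} ∂̄_{u_k}` for any linear coordinates `u = T z` that are orthonormal for it
(`A = T* T`); written in the coordinates `z` it is `∑_{i,j} (A⁻¹)_{ij} ∂_i ∂̄_j`. -/
def laplacian {d : ℕ} (A : Matrix (Fin d) (Fin d) ℂ) : BiPoly d →ₗ[ℂ] BiPoly d :=
  ∑ i, ∑ j, A⁻¹ i j •
    ((MvPolynomial.pderiv (R := ℂ) (Sum.inl i : Fin d ⊕ Fin d)).toLinearMap ∘ₗ
      (MvPolynomial.pderiv (R := ℂ) (Sum.inr j : Fin d ⊕ Fin d)).toLinearMap)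

/-- For the standard inner product this is the usual `∑_j ∂_j ∂̄_j`. -/
theorem laplacian_one {d : ℕ} (P : BiPoly d) :
    laplacian (1 : Matrix (Fin d) (Fin d) ℂ) P =
      ∑ j, MvPolynomial.pderiv (Sum.inl j) (MvPolynomial.pderiv (Sum.inr j) P) := by
  simp [laplacian, LinearMap.sum_apply, Matrix.one_apply, ite_smul]

/-- `H(p,q)`: the functions on `ℂ^d` that are polynomials in `z` and `z̄`, homogeneous of degree
`p` in `z` and `q` in `z̄`, and harmonic for the inner product `⟨v, w⟩ = v* A w`. -/
def harm {d : ℕ} (A : Matrix (Fin d) (Fin d) ℂ) (p q : ℕ) : Submodule ℂ ((Fin d → ℂ) → ℂ) :=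
  (biHom d p q ⊓ LinearMap.ker (laplacian A)).map (toFun d)

variable {d : ℕ} {G : Type*} [Group G]

/-- The inner product `⟨v, w⟩ = v* A w` on `ℂ^d` is preserved by the action of `G`. For `A = 1`
this says that the action is unitary. -/
def InvariantInner (ρ : Representation ℂ G (Fin d → ℂ)) (A : Matrix (Fin d) (Fin d) ℂ) : Prop :=
  A.PosDef ∧
    ∀ (g : G) (v w : Fin d → ℂ), star (ρ g v) ⬝ᵥ A.mulVec (ρ g w) = star v ⬝ᵥ A.mulVec w

/-- The standard inner product is allowed exactly when the action is unitary. -/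
theorem invariantInner_one_iff (ρ : Representation ℂ G (Fin d → ℂ)) :
    InvariantInner ρ 1 ↔ ∀ (g : G) (v w : Fin d → ℂ), star (ρ g v) ⬝ᵥ ρ g w = star v ⬝ᵥ w := by
  simp [InvariantInner, Matrix.PosDef.one]

/-- `V^G`, the functions in `V` with `g · f = f` for all `g`, where `(g · f)(v) = f (g⁻¹ v)`. -/
def fixedBy (ρ : Representation ℂ G (Fin d → ℂ)) (V : Submodule ℂ ((Fin d → ℂ) → ℂ)) :
    Submodule ℂ ((Fin d → ℂ) → ℂ) where
  carrier := {f | f ∈ V ∧ ∀ g : G, (fun v => f (ρ g⁻¹ v)) = f}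
  add_mem' := by
    rintro a b ⟨ha, ha'⟩ ⟨hb, hb'⟩
    exact ⟨V.add_mem ha hb, fun g => funext fun v =>
      congrArg₂ (· + ·) (congrFun (ha' g) v) (congrFun (hb' g) v)⟩
  zero_mem' := ⟨V.zero_mem, fun _ => rfl⟩
  smul_mem' := by
    rintro c a ⟨ha, ha'⟩
    exact ⟨V.smul_mem c ha, fun g => funext fun v =>
      congrArg (fun t => c • t) (congrFun (ha' g) v)⟩

/-- `dim (H(p,q)^G)`. -/
def dimHarm (ρ : Representation ℂ G (Fin d → ℂ)) (A : Matrix (Fin d) (Fin d) ℂ) (p q : ℕ) : ℕ :=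
  Module.finrank ℂ (fixedBy ρ (harm A p q))

/-- `f_g(x) = det (I - x g)`. -/
def detFun (ρ : Representation ℂ G (Fin d → ℂ)) (g : G) (x : ℂ) : ℂ :=
  LinearMap.det (1 - x • ρ g)

/-- The trace `tr(g)` of the action of `g` on `ℂ^d`. -/
def tr (ρ : Representation ℂ G (Fin d → ℂ)) (g : G) : ℂ :=
  LinearMap.trace ℂ (Fin d → ℂ) (ρ g)

/-- The trace `tr(Λ^k g)` of the action of `g` on the `k`-th exterior power of `ℂ^d`. -/
def trExt (ρ : Representation ℂ G (Fin d → ℂ)) (k : ℕ) (g : G) : ℂ :=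
  LinearMap.trace ℂ (⋀[ℂ]^k (Fin d → ℂ)) (exteriorPower.map k (ρ g))

/-- `∂_x^p ∂_y^q [(1 - x y) / (f_g(x) f_{g⁻¹}(y))]` at `(x, y) = (0, 0)`. -/
def molienTerm (ρ : Representation ℂ G (Fin d → ℂ)) (p q : ℕ) (g : G) : ℂ :=
  iteratedDeriv p (fun x : ℂ =>
    iteratedDeriv q (fun y : ℂ => (1 - x * y) / (detFun ρ g x * detFun ρ g⁻¹ y)) 0) 0

/-- The summand for `(p,q) = (1,0)`. -/
def term10 (ρ : Representation ℂ G (Fin d → ℂ)) (g : G) : ℂ := tr ρ g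

/-- The summand for `(p,q) = (2,0)`. -/
def term20 (ρ : Representation ℂ G (Fin d → ℂ)) (g : G) : ℂ := tr ρ g ^ 2 + tr ρ (g ^ 2)

/-- The summand for `(p,q) = (3,0)`. -/
def term30 (ρ : Representation ℂ G (Fin d → ℂ)) (g : G) : ℂ :=
  tr ρ g ^ 3 + 2 * tr ρ (g ^ 3) + 3 * tr ρ g * tr ρ (g ^ 2)

/-- The summand for `(p,q) = (1,1)`. -/
def term11 (ρ : Representation ℂ G (Fin d → ℂ)) (g : G) : ℂ := tr ρ g * tr ρ g⁻¹ - 1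

/-- The summand for `(p,q) = (2,1)`. -/
def term21 (ρ : Representation ℂ G (Fin d → ℂ)) (g : G) : ℂ :=
  tr ρ g ^ 2 * tr ρ g⁻¹ + tr ρ (g ^ 2) * tr ρ g⁻¹ - 2 * tr ρ g

/-- `t` is one of the summands in the formulas for the dimensions. -/
def IsSummand (ρ : Representation ℂ G (Fin d → ℂ)) (t : G → ℂ) : Prop :=
  (∃ p q, t = molienTerm ρ p q) ∨ t = term10 ρ ∨ t = term20 ρ ∨ t = term30 ρ ∨
    t = term11 ρ ∨ t = term21 ρ

end

end HarmonicMolien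

/-! Let `P(p,q)` denote the polynomials of bidegree `(p,q)`. Summing `g* g` over `G` gives an
invariant inner product. For any such product `Δ` commutes with `G` (`laplacian_linSubst`) and maps
`P(p+1,q+1)` onto `P(p,q)` (`map_laplacian_biHom`). Averaging a preimage shows that it stays onto
between invariants (`map_laplacian_invPoly`), so by rank-nullity `dim H(p+1,q+1)^G = dim
P(p+1,q+1)^G - dim P(p,q)^G`, while `Δ` is zero on `P(p,q)` when `p = 0` or `q = 0`.

The dimension of `P(p,q)^G` is the mean of a character. Each `g` has finite order, hence is
diagonalizable with roots of unity `e_i` as eigenvalues, and `star (e_i) = e_i⁻¹`. On monomials the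
trace is `h_p(e) h_q(e⁻¹)`, with `h_n` the complete homogeneous symmetric functions
(`trace_biHomRep_inv`). This is the coefficient of `x^p y^q` in `1 / (f_g(x) f_{g⁻¹}(y))`. The
factor `1 - xy` subtracts the coefficient at `(p-1,q-1)`, which is the difference above
(`molienTerm_eq`).

Newton's recursion turns `h_1, h_2, h_3` into traces of powers of `g`. The coefficients of `f_g`
itself are signed elementary symmetric functions, that is, traces on exterior powers. -/

open scoped Nat ComplexOrder

namespace HarmonicMolien

noncomputable section

/-! ### Linear substitutions in `z` and `z̄`. -/

section

section LinSubst

variable {σ : Type*} [Fintype σ]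

/-- The linear substitution `P ↦ P ∘ N` on polynomials. -/
def linSubst (N : Matrix σ σ ℂ) : MvPolynomial σ ℂ →ₐ[ℂ] MvPolynomial σ ℂ :=
  MvPolynomial.aeval fun i => ∑ j, MvPolynomial.C (N i j) * MvPolynomial.X j

theorem linSubst_X (N : Matrix σ σ ℂ) (i : σ) :
    linSubst N (MvPolynomial.X i) = ∑ j, MvPolynomial.C (N i j) * MvPolynomial.X j := by
  simp [linSubst]

/-- A polynomial over `ℂ` is determined by its values, so identities between substitutions reduce
through this to identities of matrices acting on vectors. -/
theorem eval_linSubst (N : Matrix σ σ ℂ) (x : σ → ℂ) (P : MvPolynomial σ ℂ) :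
    MvPolynomial.eval x (linSubst N P) = MvPolynomial.eval (N.mulVec x) P := by
  induction P using MvPolynomial.induction_on with
  | C a => simp
  | add p q hp hq => simp [hp, hq]
  | mul_X p i hp => simp [hp, linSubst_X, Matrix.mulVec, dotProduct]

theorem linSubst_mul (M N : Matrix σ σ ℂ) (P : MvPolynomial σ ℂ) :
    linSubst (M * N) P = linSubst N (linSubst M P) := by
  apply MvPolynomial.funext
  intro x
  simp [eval_linSubst]

theorem linSubst_one [DecidableEq σ] (P : MvPolynomial σ ℂ) : linSubst 1 P = P := by
  apply MvPolynomial.funext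
  intro x
  simp [eval_linSubst]

theorem linSubst_diagonal_monomial [DecidableEq σ] (e : σ → ℂ) (m : σ →₀ ℕ) :
    linSubst (Matrix.diagonal e) (MvPolynomial.monomial m 1) =
      (∏ i, e i ^ m i) • MvPolynomial.monomial m 1 := by
  apply MvPolynomial.funext
  intro x
  simp [eval_linSubst, MvPolynomial.eval_monomial, Matrix.mulVec_diagonal, mul_pow,
    Finsupp.prod_fintype, Finset.prod_mul_distrib]

/-- Each variable is replaced by a combination of variables of its own weight. For `conjBlock` this
means that `z` and `z̄` do not mix. -/
theorem isWeightedHomogeneous_linSubst {M : Type*} [AddCommMonoid M] {w : σ → M}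
    {N : Matrix σ σ ℂ} (hN : ∀ i j, N i j ≠ 0 → w i = w j) {P : MvPolynomial σ ℂ} {n : M}
    (hP : P.IsWeightedHomogeneous w n) : (linSubst N P).IsWeightedHomogeneous w n := by
  rw [linSubst, MvPolynomial.aeval_def, MvPolynomial.eval₂_eq']
  refine MvPolynomial.IsWeightedHomogeneous.sum _ _ _ fun m hm => ?_
  refine MvPolynomial.IsWeightedHomogeneous.C_mul ?_ _
  have h := hP (MvPolynomial.mem_support_iff.1 hm)
  rw [← h, Finsupp.weight_apply, Finsupp.sum_fintype _ _ (by simp)]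
  refine MvPolynomial.IsWeightedHomogeneous.prod _ _ _ fun i _ => ?_
  refine MvPolynomial.IsWeightedHomogeneous.pow ?_ _
  refine MvPolynomial.IsWeightedHomogeneous.sum _ _ _ fun j _ => ?_
  by_cases h0 : N i j = 0
  · simpa [h0] using MvPolynomial.isWeightedHomogeneous_zero ℂ w (w i)
  · rw [hN i j h0]
    exact (MvPolynomial.isWeightedHomogeneous_X ℂ w j).C_mul _

theorem pderiv_linSubst (N : Matrix σ σ ℂ) (i : σ) (P : MvPolynomial σ ℂ) :
    MvPolynomial.pderiv i (linSubst N P) =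
      ∑ k, N k i • linSubst N (MvPolynomial.pderiv k P) := by
  classical
  induction P using MvPolynomial.induction_on with
  | C a => simp
  | add p q hp hq => simp [hp, hq, Finset.sum_add_distrib]
  | mul_X p k hp =>
    have h : MvPolynomial.pderiv i (linSubst N (MvPolynomial.X k)) = MvPolynomial.C (N k i) := by
      simp [linSubst_X, MvPolynomial.pderiv_X, Pi.single_apply]
    simp only [map_mul, MvPolynomial.pderiv_mul, hp, h, map_add, MvPolynomial.pderiv_X,
      smul_add, Finset.sum_add_distrib, Finset.sum_mul, smul_mul_assoc]
    congr 1
    rw [Finset.sum_eq_single k]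
    · simp [MvPolynomial.smul_eq_C_mul, mul_comm]
    · intro j _ hj
      simp [hj]
    · simp

end LinSubst

variable {d : ℕ}

/-- The matrix of `(z, w) ↦ (M z, M̄ w)`. -/
def conjBlock (M : Matrix (Fin d) (Fin d) ℂ) : Matrix (Fin d ⊕ Fin d) (Fin d ⊕ Fin d) ℂ :=
  Matrix.fromBlocks M 0 0 (M.map star)

theorem conjBlock_mul (M N : Matrix (Fin d) (Fin d) ℂ) :
    conjBlock (M * N) = conjBlock M * conjBlock N := by
  simp only [conjBlock, Matrix.fromBlocks_multiply, Matrix.mul_zero, Matrix.zero_mul, add_zero,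
    zero_add]
  congr 1
  ext i j
  simp [Matrix.mul_apply]

theorem conjBlock_one : conjBlock (1 : Matrix (Fin d) (Fin d) ℂ) = 1 := by
  rw [conjBlock, Matrix.map_one _ (star_zero ℂ) (star_one ℂ), Matrix.fromBlocks_one]

theorem conjBlock_diagonal (e : Fin d → ℂ) :
    conjBlock (Matrix.diagonal e) = Matrix.diagonal (Sum.elim e (fun i => star (e i))) := by
  rw [conjBlock, Matrix.diagonal_map (star_zero ℂ), Matrix.fromBlocks_diagonal]

theorem conjBlock_mulVec (M : Matrix (Fin d) (Fin d) ℂ) (z : Fin d → ℂ) :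
    (conjBlock M).mulVec (Sum.elim z fun j => star (z j)) =
      Sum.elim (M.mulVec z) (fun j => star (M.mulVec z j)) := by
  ext i
  rcases i with i | i <;> simp [conjBlock, Matrix.mulVec, dotProduct]

theorem toFun_linSubst_conjBlock (M : Matrix (Fin d) (Fin d) ℂ) (P : BiPoly d) (z : Fin d → ℂ) :
    toFun d (linSubst (conjBlock M) P) z = toFun d P (M.mulVec z) := by
  change MvPolynomial.eval _ _ = MvPolynomial.eval _ _
  rw [eval_linSubst, conjBlock_mulVec]

theorem linSubst_conjBlock_mem_biHom (M : Matrix (Fin d) (Fin d) ℂ) {p q : ℕ} {P : BiPoly d}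
    (hP : P ∈ biHom d p q) : linSubst (conjBlock M) P ∈ biHom d p q := by
  refine isWeightedHomogeneous_linSubst ?_ hP
  rintro (i | i) (j | j) <;> simp [conjBlock, bidegree]

/-- In the coordinates `z = x + iy`, `z̄ = x - iy` the polynomial vanishes at all real `(x, y)`,
hence is zero, and this change of coordinates is invertible. -/
theorem toFun_injective (d : ℕ) : Function.Injective (toFun d) := by
  rw [← LinearMap.ker_eq_bot, LinearMap.ker_eq_bot']
  intro P hP
  let N : Matrix (Fin d ⊕ Fin d) (Fin d ⊕ Fin d) ℂ :=
    Matrix.fromBlocks 1 (Complex.I • 1) 1 (-Complex.I • 1)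
  -- The inverse change: `x = (z + z̄)/2`, `y = (z - z̄)/(2i)`.
  let N' : Matrix (Fin d ⊕ Fin d) (Fin d ⊕ Fin d) ℂ :=
    Matrix.fromBlocks ((1 / 2 : ℂ) • 1) ((1 / 2 : ℂ) • 1) ((-Complex.I / 2) • 1)
      ((Complex.I / 2) • 1)
  have hNN : N * N' = 1 := by
    have h1 : (1 / 2 : ℂ) + Complex.I * (-Complex.I / 2) = 1 := by
      linear_combination (-1 / 2 : ℂ) * Complex.I_mul_I
    have h2 : (1 / 2 : ℂ) + Complex.I * (Complex.I / 2) = 0 := by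
      linear_combination (1 / 2 : ℂ) * Complex.I_mul_I
    have h3 : (1 / 2 : ℂ) + -Complex.I * (-Complex.I / 2) = 0 := by
      linear_combination (1 / 2 : ℂ) * Complex.I_mul_I
    have h4 : (1 / 2 : ℂ) + -Complex.I * (Complex.I / 2) = 1 := by
      linear_combination (-1 / 2 : ℂ) * Complex.I_mul_I
    rw [← Matrix.fromBlocks_one, Matrix.fromBlocks_multiply]
    simp only [Matrix.one_mul, Matrix.smul_mul, smul_smul, ← add_smul, h1, h2, h3, h4, one_smul,
      zero_smul]
  have h0 : linSubst N P = 0 := by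
    refine MvPolynomial.funext_set (fun _ => Set.range ((↑) : ℝ → ℂ))
      (fun _ => Set.infinite_range_of_injective Complex.ofReal_injective) fun x hx => ?_
    have hx' : ∀ i, star (x i) = x i := by
      intro i
      obtain ⟨r, hr⟩ := hx i (Set.mem_univ i)
      simp [← hr]
    have hv : N.mulVec x = Sum.elim (fun i => x (Sum.inl i) + Complex.I * x (Sum.inr i))
        (fun j => star (x (Sum.inl j) + Complex.I * x (Sum.inr j))) := by
      ext i
      rcases i with i | i
      · simp [N, Matrix.mulVec, dotProduct, Matrix.one_apply]
      · rw [Sum.elim_inr, star_add, star_mul', hx', hx']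
        simp [N, Matrix.mulVec, dotProduct, Matrix.one_apply]
    rw [eval_linSubst, hv, map_zero]
    exact congrFun hP _
  rw [← linSubst_one P, ← hNN, linSubst_mul, h0, map_zero]

end

/-! ### The Laplacian: equivariance and surjectivity. -/

section

variable {d : ℕ}

theorem laplacian_apply (A : Matrix (Fin d) (Fin d) ℂ) (P : BiPoly d) :
    laplacian A P = ∑ i, ∑ j, A⁻¹ i j •
      MvPolynomial.pderiv (Sum.inl i) (MvPolynomial.pderiv (Sum.inr j) P) := by
  simp [laplacian, LinearMap.sum_apply]

theorem pderiv_inl_linSubst_conjBlock (M : Matrix (Fin d) (Fin d) ℂ) (i : Fin d) (P : BiPoly d) :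
    MvPolynomial.pderiv (Sum.inl i) (linSubst (conjBlock M) P) =
      ∑ k, M k i • linSubst (conjBlock M) (MvPolynomial.pderiv (Sum.inl k) P) := by
  simp [pderiv_linSubst, conjBlock]

theorem pderiv_inr_linSubst_conjBlock (M : Matrix (Fin d) (Fin d) ℂ) (i : Fin d) (P : BiPoly d) :
    MvPolynomial.pderiv (Sum.inr i) (linSubst (conjBlock M) P) =
      ∑ k, star (M k i) • linSubst (conjBlock M) (MvPolynomial.pderiv (Sum.inr k) P) := by
  simp [pderiv_linSubst, conjBlock]

theorem sum_comm_reverse₄ {ι M : Type*} [Fintype ι] [AddCommMonoid M] (F : ι → ι → ι → ι → M) :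
    ∑ i, ∑ j, ∑ l, ∑ k, F i j l k = ∑ k, ∑ l, ∑ j, ∑ i, F i j l k := by
  have h3 : ∀ i, ∑ j, ∑ l, ∑ k, F i j l k = ∑ k, ∑ l, ∑ j, F i j l k := fun i => calc
    ∑ j, ∑ l, ∑ k, F i j l k = ∑ j, ∑ k, ∑ l, F i j l k :=
      Finset.sum_congr rfl fun _ _ => Finset.sum_comm
    _ = ∑ k, ∑ j, ∑ l, F i j l k := Finset.sum_comm
    _ = _ := Finset.sum_congr rfl fun _ _ => Finset.sum_comm
  calc ∑ i, ∑ j, ∑ l, ∑ k, F i j l k = ∑ i, ∑ k, ∑ l, ∑ j, F i j l k :=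
      Finset.sum_congr rfl fun i _ => h3 i
    _ = ∑ k, ∑ i, ∑ l, ∑ j, F i j l k := Finset.sum_comm
    _ = ∑ k, ∑ l, ∑ i, ∑ j, F i j l k := Finset.sum_congr rfl fun _ _ => Finset.sum_comm
    _ = _ := Finset.sum_congr rfl fun _ _ => Finset.sum_congr rfl fun _ _ => Finset.sum_comm

theorem mul_inv_mul_conjTranspose {A M : Matrix (Fin d) (Fin d) ℂ} (hA : IsUnit A.det)
    (h : M.conjTranspose * A * M = A) : M * A⁻¹ * M.conjTranspose = A⁻¹ := by
  have hdet := congrArg Matrix.det h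
  rw [Matrix.det_mul] at hdet
  have hM : IsUnit M.det := by
    rw [← hdet] at hA
    exact isUnit_of_mul_isUnit_right hA
  have hM' : IsUnit M.conjTranspose.det := by
    rw [Matrix.det_conjTranspose]
    exact hM.star
  have hinv : A⁻¹ = M⁻¹ * (A⁻¹ * M.conjTranspose⁻¹) := by
    conv_lhs => rw [← h]
    rw [Matrix.mul_inv_rev, Matrix.mul_inv_rev]
  conv_lhs => rw [hinv]
  rw [Matrix.mul_nonsing_inv_cancel_left _ _ hM, Matrix.nonsing_inv_mul_cancel_right _ _ hM']

/-- By the chain rule, substituting `M` replaces the coefficient matrix `A⁻¹` by `M A⁻¹ M*`, which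
is `A⁻¹` again because `M` preserves `A`. -/
theorem laplacian_linSubst {A M : Matrix (Fin d) (Fin d) ℂ} (hA : IsUnit A.det)
    (h : M.conjTranspose * A * M = A) (P : BiPoly d) :
    laplacian A (linSubst (conjBlock M) P) = linSubst (conjBlock M) (laplacian A P) := by
  have hinv := mul_inv_mul_conjTranspose hA h
  have hentry : ∀ k l, A⁻¹ k l = ∑ j, ∑ i, A⁻¹ i j * star (M l j) * M k i := by
    intro k l
    conv_lhs => rw [← hinv]
    rw [Matrix.mul_apply]
    refine Finset.sum_congr rfl fun j _ => ?_
    rw [Matrix.mul_apply, Finset.sum_mul]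
    refine Finset.sum_congr rfl fun i _ => ?_
    rw [Matrix.conjTranspose_apply]
    ring
  rw [laplacian_apply, laplacian_apply]
  simp only [pderiv_inr_linSubst_conjBlock, pderiv_inl_linSubst_conjBlock, map_sum, map_smul,
    Derivation.map_smul, Finset.smul_sum, smul_smul]
  have hr : ∀ k l, A⁻¹ k l • linSubst (conjBlock M)
      (MvPolynomial.pderiv (Sum.inl k) (MvPolynomial.pderiv (Sum.inr l) P)) =
      ∑ j, ∑ i, (A⁻¹ i j * star (M l j) * M k i) • linSubst (conjBlock M)
        (MvPolynomial.pderiv (Sum.inl k) (MvPolynomial.pderiv (Sum.inr l) P)) := by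
    intro k l
    conv_lhs => rw [hentry k l]
    simp only [Finset.sum_smul]
  simp only [hr]
  rw [sum_comm_reverse₄]
  simp only [mul_assoc]

theorem laplacian_mem_biHom (A : Matrix (Fin d) (Fin d) ℂ) {p q : ℕ} {P : BiPoly d}
    (hP : P ∈ biHom d (p + 1) (q + 1)) : laplacian A P ∈ biHom d p q := by
  rw [laplacian_apply]
  refine Submodule.sum_mem _ fun i _ => Submodule.sum_mem _ fun j _ => Submodule.smul_mem _ _ ?_
  have h1 : (MvPolynomial.pderiv (Sum.inr j) P).IsWeightedHomogeneous (bidegree d) (p + 1, q) :=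
    MvPolynomial.IsWeightedHomogeneous.pderiv hP (by simp [bidegree])
  exact h1.pderiv (by simp [bidegree])

theorem weight_bidegree (m : Fin d ⊕ Fin d →₀ ℕ) :
    Finsupp.weight (bidegree d) m = (∑ i, m (Sum.inl i), ∑ i, m (Sum.inr i)) := by
  rw [Finsupp.weight_apply, Finsupp.sum_fintype _ _ (by simp)]
  simp [bidegree, Prod.ext_iff, Prod.fst_sum, Prod.snd_sum]

theorem pderiv_inl_eq_zero {q : ℕ} {P : BiPoly d} (hP : P ∈ biHom d 0 q) (i : Fin d) :
    MvPolynomial.pderiv (Sum.inl i) P = 0 := by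
  ext m
  rw [MvPolynomial.coeff_pderiv, MvPolynomial.coeff_zero]
  rw [MvPolynomial.IsWeightedHomogeneous.coeff_eq_zero hP, zero_mul]
  rw [weight_bidegree]
  intro h
  have := congrArg Prod.fst h
  simp only [Finset.sum_eq_zero_iff, Finset.mem_univ, true_implies] at this
  simpa using this i

theorem pderiv_inr_eq_zero {p : ℕ} {P : BiPoly d} (hP : P ∈ biHom d p 0) (i : Fin d) :
    MvPolynomial.pderiv (Sum.inr i) P = 0 := by
  ext m
  rw [MvPolynomial.coeff_pderiv, MvPolynomial.coeff_zero]
  rw [MvPolynomial.IsWeightedHomogeneous.coeff_eq_zero hP, zero_mul]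
  rw [weight_bidegree]
  intro h
  have := congrArg Prod.snd h
  simp only [Finset.sum_eq_zero_iff, Finset.mem_univ, true_implies] at this
  simpa using this i

theorem laplacian_eq_zero_of_zero_left (A : Matrix (Fin d) (Fin d) ℂ) {q : ℕ} {P : BiPoly d}
    (hP : P ∈ biHom d 0 q) : laplacian A P = 0 := by
  rw [laplacian_apply]
  refine Finset.sum_eq_zero fun i _ => Finset.sum_eq_zero fun j _ => ?_
  cases q with
  | zero => rw [pderiv_inr_eq_zero hP, map_zero, smul_zero]
  | succ q =>
    have h : (MvPolynomial.pderiv (Sum.inr j) P).IsWeightedHomogeneous (bidegree d) (0, q) :=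
      MvPolynomial.IsWeightedHomogeneous.pderiv hP (by simp [bidegree])
    rw [pderiv_inl_eq_zero h, smul_zero]

theorem laplacian_eq_zero_of_zero_right (A : Matrix (Fin d) (Fin d) ℂ) {p : ℕ} {P : BiPoly d}
    (hP : P ∈ biHom d p 0) : laplacian A P = 0 := by
  rw [laplacian_apply]
  refine Finset.sum_eq_zero fun i _ => Finset.sum_eq_zero fun j _ => ?_
  rw [pderiv_inr_eq_zero hP, map_zero, smul_zero]

/-- Induction on the degree of `m` in the variables other than `z_o`, `z̄_o`. The Laplacian of `z_o
z̄_o m` is a nonzero multiple of `m` plus monomials in which that degree is smaller, since every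
`∂_i ∂̄_j` with `(i,j) ≠ (o,o)` removes one of the other variables. -/
theorem monomial_mem_map_laplacian {A : Matrix (Fin d) (Fin d) ℂ} {o : Fin d} (ho : A⁻¹ o o ≠ 0)
    (p q : ℕ) (m : Fin d ⊕ Fin d →₀ ℕ) (hm : Finsupp.weight (bidegree d) m = (p, q)) :
    (MvPolynomial.monomial m 1 : BiPoly d) ∈ (biHom d (p + 1) (q + 1)).map (laplacian A) := by
  classical
  set R := (biHom d (p + 1) (q + 1)).map (laplacian A)
  let S : Finset (Fin d ⊕ Fin d) := {Sum.inl o, Sum.inr o}ᶜ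
  induction hr : ∑ k ∈ S, m k using Nat.strong_induction_on generalizing m with
  | _ r ih =>
  let m' := m + Finsupp.single (Sum.inl o) 1 + Finsupp.single (Sum.inr o) 1
  have hm' : Finsupp.weight (bidegree d) m' = (p + 1, q + 1) := by
    rw [map_add, map_add, hm]
    simp [Finsupp.weight_single, bidegree]
  have hmem : laplacian A (MvPolynomial.monomial m' 1) ∈ R :=
    Submodule.mem_map_of_mem (MvPolynomial.isWeightedHomogeneous_monomial _ _ _ hm')
  have hoff : ∀ x : Fin d × Fin d, x ≠ (o, o) → MvPolynomial.pderiv (Sum.inl x.1)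
      (MvPolynomial.pderiv (Sum.inr x.2) (MvPolynomial.monomial m' (1 : ℂ))) ∈ R := by
    rintro ⟨i, j⟩ hij
    have hw : (MvPolynomial.pderiv (Sum.inl i) (MvPolynomial.pderiv (Sum.inr j)
        (MvPolynomial.monomial m' (1 : ℂ)))).IsWeightedHomogeneous (bidegree d) (p, q) := by
      refine MvPolynomial.IsWeightedHomogeneous.pderiv
        (MvPolynomial.IsWeightedHomogeneous.pderiv (n' := (p + 1, q))
          (MvPolynomial.isWeightedHomogeneous_monomial _ _ _ hm') ?_) ?_ <;> simp [bidegree]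
    dsimp only
    rw [MvPolynomial.pderiv_monomial, MvPolynomial.pderiv_monomial] at hw ⊢
    set m'' := m' - Finsupp.single (Sum.inr j) 1 - Finsupp.single (Sum.inl i) 1 with hm''
    set c : ℂ := _ * _ with hc
    -- Subtraction of exponents is truncated; where it truncates, the coefficient `c` is zero.
    by_cases hc0 : c = 0
    · rw [hc0, map_zero]
      exact R.zero_mem
    rw [← mul_one c, ← smul_eq_mul, ← MvPolynomial.smul_monomial]
    refine R.smul_mem _ (ih _ ?_ m'' (hw (by simpa [MvPolynomial.coeff_monomial] using hc0)) rfl)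
    have hj : m' (Sum.inr j) ≠ 0 := fun h => hc0 (by simp [hc, h])
    have hi : m' (Sum.inl i) ≠ 0 := fun h => hc0 (by simp [hc, h])
    rw [← hr]
    have hle : ∀ k ∈ S, m'' k ≤ m k := by
      intro k hk
      simp only [S, Finset.mem_compl, Finset.mem_insert, Finset.mem_singleton, not_or] at hk
      simp [hm'', m', Finsupp.single_apply, Ne.symm hk.1, Ne.symm hk.2]
      omega
    refine Finset.sum_lt_sum hle ?_
    by_cases hio : i = o
    · have hjo : j ≠ o := fun h => hij (by rw [hio, h])
      refine ⟨Sum.inr j, by simp [S, hjo], ?_⟩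
      simp [m', Ne.symm hjo] at hj
      simp [hm'', m', Ne.symm hjo]
      omega
    · refine ⟨Sum.inl i, by simp [S, hio], ?_⟩
      simp [m', Ne.symm hio] at hi
      simp [hm'', m', Ne.symm hio]
      omega
  have hdiag : MvPolynomial.pderiv (Sum.inl o)
      (MvPolynomial.pderiv (Sum.inr o) (MvPolynomial.monomial m' (1 : ℂ))) =
      (((m (Sum.inl o) : ℂ) + 1) * (m (Sum.inr o) + 1)) • MvPolynomial.monomial m 1 := by
    rw [MvPolynomial.pderiv_monomial, MvPolynomial.pderiv_monomial, MvPolynomial.smul_monomial]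
    have h1 : m' - Finsupp.single (Sum.inr o) 1 = m + Finsupp.single (Sum.inl o) 1 := by
      simp [m']
    rw [h1, add_tsub_cancel_right]
    congr 1
    simp [m', mul_comm]
  rw [laplacian_apply, ← Finset.sum_product', Finset.univ_product_univ,
    ← Finset.add_sum_erase _ _ (Finset.mem_univ (o, o)), hdiag, smul_smul] at hmem
  have h2 := (Submodule.add_mem_iff_left R (Submodule.sum_mem _ fun x hx =>
    R.smul_mem (A⁻¹ x.1 x.2) (hoff x (Finset.ne_of_mem_erase hx)))).1 hmem
  refine (Submodule.smul_mem_iff R ?_).1 h2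
  exact mul_ne_zero ho (mul_ne_zero (Nat.cast_add_one_ne_zero _) (Nat.cast_add_one_ne_zero _))

theorem map_laplacian_biHom {A : Matrix (Fin d) (Fin d) ℂ} {o : Fin d} (ho : A⁻¹ o o ≠ 0)
    (p q : ℕ) : (biHom d (p + 1) (q + 1)).map (laplacian A) = biHom d p q := by
  refine le_antisymm (Submodule.map_le_iff_le_comap.2 fun P hP => laplacian_mem_biHom A hP) ?_
  intro P hP
  rw [P.as_sum]
  refine Submodule.sum_mem _ fun m hm => ?_
  rw [← mul_one (MvPolynomial.coeff m P), ← smul_eq_mul, ← MvPolynomial.smul_monomial]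
  exact Submodule.smul_mem _ _
    (monomial_mem_map_laplacian ho p q m (hP (MvPolynomial.mem_support_iff.1 hm)))

end

/-! ### Characters of `G` on polynomials of bidegree `(p,q)`. -/

section

theorem trace_eq_sum_of_eigenbasis {ι V : Type*} [Fintype ι] [AddCommGroup V] [Module ℂ V]
    (b : Module.Basis ι ℂ V) (f : V →ₗ[ℂ] V) (c : ι → ℂ) (h : ∀ i, f (b i) = c i • b i) :
    LinearMap.trace ℂ V f = ∑ i, c i := by
  classical
  rw [LinearMap.trace_eq_matrix_trace ℂ b, Matrix.trace]
  refine Finset.sum_congr rfl fun i _ => ?_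
  simp [LinearMap.toMatrix_apply, h]

/-- The averaging operator is a projection onto the invariants, so its trace is their dimension. -/
theorem finrank_invariants_eq {G V : Type*} [Group G] [Fintype G] [AddCommGroup V] [Module ℂ V]
    [FiniteDimensional ℂ V] (τ : Representation ℂ G V) :
    (Module.finrank ℂ τ.invariants : ℂ) =
      1 / (Fintype.card G : ℂ) * ∑ g : G, LinearMap.trace ℂ V (τ g) := by
  have : Invertible (Fintype.card G : ℂ) :=
    invertibleOfNonzero (Nat.cast_ne_zero.2 Fintype.card_ne_zero)
  rw [← (Representation.isProj_averageMap τ).trace]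
  simp [Representation.averageMap, GroupAlgebra.average, map_sum, Representation.asAlgebraHom_single]

variable {d : ℕ} {G : Type*} [Group G]

/-- The matrix of `g` in the standard basis. -/
def mat (ρ : Representation ℂ G (Fin d → ℂ)) (g : G) : Matrix (Fin d) (Fin d) ℂ :=
  LinearMap.toMatrix' (ρ g)

theorem mat_mulVec (ρ : Representation ℂ G (Fin d → ℂ)) (g : G) (v : Fin d → ℂ) :
    (mat ρ g).mulVec v = ρ g v := by
  simp [mat, LinearMap.toMatrix'_mulVec]

theorem mat_mul (ρ : Representation ℂ G (Fin d → ℂ)) (g h : G) :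
    mat ρ (g * h) = mat ρ g * mat ρ h := by
  simp [mat, LinearMap.toMatrix'_mul]

theorem mat_one (ρ : Representation ℂ G (Fin d → ℂ)) : mat ρ 1 = 1 := by
  simp [mat]

/-- The action `(g · P)(v) = P (g⁻¹ v)` on polynomials in `z` and `z̄`. -/
def polyRep (ρ : Representation ℂ G (Fin d → ℂ)) : Representation ℂ G (BiPoly d) where
  toFun g := (linSubst (conjBlock (mat ρ g⁻¹))).toLinearMap
  map_one' := by
    apply LinearMap.ext
    intro P
    simp only [inv_one, mat_one, conjBlock_one]
    exact linSubst_one P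
  map_mul' g h := by
    apply LinearMap.ext
    intro P
    simp only [mul_inv_rev, mat_mul, conjBlock_mul]
    exact linSubst_mul _ _ P

theorem polyRep_apply (ρ : Representation ℂ G (Fin d → ℂ)) (g : G) (P : BiPoly d) :
    polyRep ρ g P = linSubst (conjBlock (mat ρ g⁻¹)) P := rfl

theorem toFun_polyRep (ρ : Representation ℂ G (Fin d → ℂ)) (g : G) (P : BiPoly d) :
    toFun d (polyRep ρ g P) = fun v => toFun d P (ρ g⁻¹ v) := by
  funext v
  rw [polyRep_apply, toFun_linSubst_conjBlock, mat_mulVec]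

/-- The substitution by `M` on the polynomials of bidegree `(p,q)`. -/
def biSubst (p q : ℕ) (M : Matrix (Fin d) (Fin d) ℂ) : biHom d p q →ₗ[ℂ] biHom d p q :=
  (linSubst (conjBlock M)).toLinearMap.restrict fun _ hP => linSubst_conjBlock_mem_biHom M hP

/-- Substitution reverses products, which is why the actions substitute the matrix of `g⁻¹`. -/
theorem biSubst_mul (p q : ℕ) (M N : Matrix (Fin d) (Fin d) ℂ) :
    biSubst p q (M * N) = biSubst p q N * biSubst p q M := by
  apply LinearMap.ext
  intro P
  apply Subtype.ext
  change linSubst (conjBlock (M * N)) _ = linSubst (conjBlock N) (linSubst (conjBlock M) _)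
  rw [conjBlock_mul, linSubst_mul]

theorem biSubst_one (p q : ℕ) : biSubst p q (1 : Matrix (Fin d) (Fin d) ℂ) = 1 := by
  apply LinearMap.ext
  intro P
  apply Subtype.ext
  change linSubst (conjBlock 1) _ = _
  rw [conjBlock_one, linSubst_one]
  rfl

/-- The action of `G` on the polynomials of bidegree `(p,q)`. -/
def biHomRep (ρ : Representation ℂ G (Fin d → ℂ)) (p q : ℕ) :
    Representation ℂ G (biHom d p q) where
  toFun g := biSubst p q (mat ρ g⁻¹)
  map_one' := by rw [inv_one, mat_one, biSubst_one]
  map_mul' g h := by rw [mul_inv_rev, mat_mul, biSubst_mul]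

/-- The exponents of bidegree `(p,q)`. -/
abbrev BiExp (d p q : ℕ) : Type :=
  {m : Fin d ⊕ Fin d →₀ ℕ // Finsupp.weight (bidegree d) m = (p, q)}

/-- The exponents of bidegree `(p,q)` are the pairs of an exponent of degree `p` and one of
degree `q`. -/
def biExpEquiv (d p q : ℕ) : BiExp d p q ≃
    {x // x ∈ (Finset.univ : Finset (Fin d)).finsuppAntidiag p ×ˢ
      (Finset.univ : Finset (Fin d)).finsuppAntidiag q} :=
  Finsupp.sumFinsuppEquivProdFinsupp.subtypeEquiv fun m => by
    simp only [weight_bidegree, Finset.mem_product, Finset.mem_finsuppAntidiag, Prod.mk.injEq,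
      Finset.subset_univ, and_true]
    rfl

instance (d p q : ℕ) : Fintype (BiExp d p q) := Fintype.ofEquiv _ (biExpEquiv d p q).symm

/-- The monomial basis of the polynomials of bidegree `(p,q)`. -/
def biHomBasis (d p q : ℕ) : Module.Basis (BiExp d p q) ℂ (biHom d p q) :=
  Module.Basis.mk (v := fun m => ⟨MvPolynomial.monomial m.1 1,
      MvPolynomial.isWeightedHomogeneous_monomial _ _ _ m.2⟩)
    (by
      refine LinearIndependent.of_comp (biHom d p q).subtype ?_
      have h := (MvPolynomial.basisMonomials (Fin d ⊕ Fin d) ℂ).linearIndependent.comp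
        (Subtype.val : BiExp d p q → _) Subtype.val_injective
      rw [MvPolynomial.coe_basisMonomials] at h
      exact h)
    (by
      rintro ⟨P, hP⟩ -
      have hsum : (⟨P, hP⟩ : biHom d p q) = ∑ m ∈ P.support.attach, MvPolynomial.coeff m.1 P •
          (⟨MvPolynomial.monomial m.1 1, MvPolynomial.isWeightedHomogeneous_monomial _ _ _
            (hP (MvPolynomial.mem_support_iff.1 m.2))⟩ : biHom d p q) := by
        apply Subtype.ext
        refine (MvPolynomial.support_sum_monomial_coeff P).symm.trans ?_
        rw [← Finset.sum_attach]
        simp [MvPolynomial.smul_monomial]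
      rw [hsum]
      exact Submodule.sum_mem _ fun m _ => Submodule.smul_mem _ _ (Submodule.subset_span
        ⟨⟨m.1, hP (MvPolynomial.mem_support_iff.1 m.2)⟩, rfl⟩))

theorem biHomBasis_apply (d p q : ℕ) (m : BiExp d p q) :
    (biHomBasis d p q m : BiPoly d) = MvPolynomial.monomial m.1 1 := by
  simp [biHomBasis]

instance (d p q : ℕ) : FiniteDimensional ℂ (biHom d p q) :=
  Module.Finite.of_basis (biHomBasis d p q)

/-- The complete homogeneous symmetric function of degree `n` of the family `e`, as a coefficient
of `∏ᵢ 1 / (1 - eᵢ X)`. -/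
def homSymm {ι : Type*} [Fintype ι] (e : ι → ℂ) (n : ℕ) : ℂ :=
  PowerSeries.coeff n (∏ i, PowerSeries.mk fun k => e i ^ k)

theorem homSymm_eq_sum {ι : Type*} [Fintype ι] [DecidableEq ι] (e : ι → ℂ) (n : ℕ) :
    homSymm e n = ∑ m ∈ (Finset.univ : Finset ι).finsuppAntidiag n, ∏ i, e i ^ m i := by
  simp [homSymm, PowerSeries.coeff_prod]

/-- Monomials are eigenvectors, and the sum of the eigenvalues factors into a `z` part and a `z̄`
part. -/
theorem trace_biSubst_diagonal (p q : ℕ) (e : Fin d → ℂ) :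
    LinearMap.trace ℂ _ (biSubst p q (Matrix.diagonal e)) =
      homSymm e p * homSymm (fun i => star (e i)) q := by
  rw [trace_eq_sum_of_eigenbasis (biHomBasis d p q) _
    (fun m => (∏ i, e i ^ m.1 (Sum.inl i)) * ∏ i, star (e i) ^ m.1 (Sum.inr i))]
  · rw [homSymm_eq_sum, homSymm_eq_sum, Finset.sum_mul_sum, ← Finset.sum_product']
    exact ((biExpEquiv d p q).sum_comp fun x =>
      (∏ i, e i ^ x.1.1 i) * ∏ i, star (e i) ^ x.1.2 i).trans (Finset.sum_coe_sort _
        fun x : (Fin d →₀ ℕ) × (Fin d →₀ ℕ) => (∏ i, e i ^ x.1 i) * ∏ i, star (e i) ^ x.2 i)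
  · intro m
    apply Subtype.ext
    change linSubst (conjBlock (Matrix.diagonal e)) (biHomBasis d p q m : BiPoly d) = _
    rw [Submodule.coe_smul, biHomBasis_apply, conjBlock_diagonal, linSubst_diagonal_monomial,
      Fintype.prod_sum_type]
    rfl

theorem trace_biSubst (p q : ℕ) {M P Q : Matrix (Fin d) (Fin d) ℂ} {e : Fin d → ℂ}
    (hQP : Q * P = 1) (hM : M = P * Matrix.diagonal e * Q) :
    LinearMap.trace ℂ _ (biSubst p q M) = homSymm e p * homSymm (fun i => star (e i)) q := by
  rw [hM, biSubst_mul, biSubst_mul, ← mul_assoc, LinearMap.trace_mul_cycle, ← biSubst_mul, hQP,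
    biSubst_one, one_mul, trace_biSubst_diagonal]

end

/-! ### Eigenvalues of elements of finite order. -/

section

/-- `X^n - 1` is separable in characteristic zero, so `f` is semisimple and its eigenspaces
decompose `V`. -/
theorem exists_eigenbasis_of_pow_eq_one {V : Type*} [AddCommGroup V] [Module ℂ V]
    [FiniteDimensional ℂ V] {d : ℕ} (hd : Module.finrank ℂ V = d) {f : Module.End ℂ V} {n : ℕ}
    (hn : n ≠ 0) (hf : f ^ n = 1) :
    ∃ (b : Module.Basis (Fin d) ℂ V) (e : Fin d → ℂ), ∀ i, f (b i) = e i • b i := by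
  have hss : f.IsSemisimple := by
    refine Module.End.isSemisimple_of_squarefree_aeval_eq_zero
      (p := (Polynomial.X ^ n - 1 : Polynomial ℂ)) ?_ (by simp [hf])
    exact (Polynomial.X_pow_sub_one_separable_iff.2 (Nat.cast_ne_zero.2 hn)).squarefree
  have hint := DirectSum.isInternal_submodule_of_iSupIndep_of_iSup_eq_top
    f.eigenspaces_iSupIndep hss.iSup_eigenspace_eq_top
  let b := hint.collectedBasis fun μ => Module.finBasis ℂ (f.eigenspace μ)
  have := Module.Finite.finite_basis b
  have := Fintype.ofFinite (Σ μ : ℂ, Fin (Module.finrank ℂ (f.eigenspace μ)))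
  let w := Fintype.equivFinOfCardEq ((Module.finrank_eq_card_basis b).symm.trans hd)
  refine ⟨b.reindex w, fun i => (w.symm i).1, fun i => ?_⟩
  rw [Module.Basis.reindex_apply]
  exact Module.End.mem_eigenspace_iff.1 (hint.collectedBasis_mem _ _)

variable {d : ℕ} {G : Type*} [Group G]

theorem exists_eigenbasis [Finite G] (ρ : Representation ℂ G (Fin d → ℂ)) (g : G) :
    ∃ (b : Module.Basis (Fin d) ℂ (Fin d → ℂ)) (e : Fin d → ℂ), ∀ i, ρ g (b i) = e i • b i :=
  exists_eigenbasis_of_pow_eq_one (by simp) (Nat.card_pos (α := G)).ne'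
    (by rw [← map_pow, pow_card_eq_one', map_one])

section Eigenbasis

variable {ρ : Representation ℂ G (Fin d → ℂ)} {g : G}
  {b : Module.Basis (Fin d) ℂ (Fin d → ℂ)} {e : Fin d → ℂ}

theorem eigenbasis_pow (h : ∀ i, ρ g (b i) = e i • b i) (k : ℕ) (i : Fin d) :
    ρ (g ^ k) (b i) = (e i ^ k) • b i := by
  induction k with
  | zero => simp
  | succ k ih => rw [pow_succ, map_mul, Module.End.mul_apply, h, map_smul, ih, smul_smul, pow_succ,
      mul_comm]

theorem eigenvalue_pow_card [Finite G] (h : ∀ i, ρ g (b i) = e i • b i) (i : Fin d) :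
    e i ^ Nat.card G = 1 := by
  have h1 := eigenbasis_pow h (Nat.card G) i
  rw [pow_card_eq_one', map_one, Module.End.one_apply] at h1
  have h2 : (1 - e i ^ Nat.card G) • b i = 0 := by rw [sub_smul, one_smul, ← h1, sub_self]
  exact (sub_eq_zero.1 ((smul_eq_zero.1 h2).resolve_right (b.ne_zero i))).symm

theorem eigenvalue_ne_zero [Finite G] (h : ∀ i, ρ g (b i) = e i • b i) (i : Fin d) :
    e i ≠ 0 := by
  intro h0
  have := eigenvalue_pow_card h i
  rw [h0, zero_pow (Nat.card_pos (α := G)).ne'] at this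
  exact zero_ne_one this

/-- Roots of unity have norm one. This is how `g⁻¹` comes to account for the conjugate variables. -/
theorem star_eigenvalue [Finite G] (h : ∀ i, ρ g (b i) = e i • b i) (i : Fin d) :
    star (e i) = (e i)⁻¹ := by
  rw [Complex.inv_eq_conj
    (Complex.norm_eq_one_of_pow_eq_one (eigenvalue_pow_card h i) (Nat.card_pos (α := G)).ne')]
  rfl

theorem eigenbasis_inv [Finite G] (h : ∀ i, ρ g (b i) = e i • b i) (i : Fin d) :
    ρ g⁻¹ (b i) = (e i)⁻¹ • b i := by
  have h1 : ρ g⁻¹ (ρ g (b i)) = b i := by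
    rw [← Module.End.mul_apply, ← map_mul, inv_mul_cancel, map_one, Module.End.one_apply]
  rw [h, map_smul] at h1
  conv_rhs => rw [← h1]
  rw [smul_smul, inv_mul_cancel₀ (eigenvalue_ne_zero h i), one_smul]

theorem toMatrix_eigenbasis (h : ∀ i, ρ g (b i) = e i • b i) :
    LinearMap.toMatrix b b (ρ g) = Matrix.diagonal e := by
  ext i j
  rw [LinearMap.toMatrix_apply, h, map_smul, Module.Basis.repr_self, Matrix.diagonal_apply]
  by_cases hij : i = j <;> simp [hij]

theorem exists_mat_eq_conj_diagonal (h : ∀ i, ρ g (b i) = e i • b i) :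
    ∃ P Q : Matrix (Fin d) (Fin d) ℂ, Q * P = 1 ∧ mat ρ g = P * Matrix.diagonal e * Q := by
  refine ⟨(Pi.basisFun ℂ (Fin d)).toMatrix b, b.toMatrix (Pi.basisFun ℂ (Fin d)),
    Module.Basis.toMatrix_mul_toMatrix_flip _ _, ?_⟩
  rw [← toMatrix_eigenbasis h, basis_toMatrix_mul_linearMap_toMatrix_mul_basis_toMatrix]
  rfl

theorem tr_eq_sum (h : ∀ i, ρ g (b i) = e i • b i) : tr ρ g = ∑ i, e i :=
  trace_eq_sum_of_eigenbasis b _ _ h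

theorem detFun_eq_prod (h : ∀ i, ρ g (b i) = e i • b i) (x : ℂ) :
    detFun ρ g x = ∏ i, (1 - e i * x) := by
  rw [detFun, ← LinearMap.det_toMatrix b, map_sub, LinearMap.toMatrix_one, map_smul,
    toMatrix_eigenbasis h, ← Matrix.diagonal_one, ← Matrix.diagonal_smul, Matrix.diagonal_sub,
    Matrix.det_diagonal]
  simp [mul_comm]

theorem roots_charpoly_eq (h : ∀ i, ρ g (b i) = e i • b i) :
    (ρ g).charpoly.roots = Finset.univ.val.map e := by
  rw [← LinearMap.charpoly_toMatrix (ρ g) b, toMatrix_eigenbasis h, Matrix.charpoly_diagonal,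
    ← Polynomial.roots_multiset_prod_X_sub_C (Finset.univ.val.map e), Multiset.map_map]
  rfl

/-- `g⁻¹` acts by `P ↦ P ∘ g`, so the eigenvalues `e` of `g` appear uninverted in the `z` factor. -/
theorem trace_biHomRep_inv [Finite G] (h : ∀ i, ρ g (b i) = e i • b i) (p q : ℕ) :
    LinearMap.trace ℂ _ (biHomRep ρ p q g⁻¹) =
      homSymm e p * homSymm (fun i => (e i)⁻¹) q := by
  obtain ⟨P, Q, hQP, hM⟩ := exists_mat_eq_conj_diagonal h
  have h1 : biHomRep ρ p q g⁻¹ = biSubst p q (mat ρ g) := by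
    change biSubst p q (mat ρ g⁻¹⁻¹) = _
    rw [inv_inv]
  rw [h1, trace_biSubst p q hQP hM]
  simp only [star_eigenvalue h]

end Eigenbasis

end

/-! ### Taylor series, symmetric functions and the Molien terms. -/

section

/-- The Taylor series at `0`. -/
def taylor (f : ℂ → ℂ) : PowerSeries ℂ := PowerSeries.mk fun n => iteratedDeriv n f 0 / (n ! : ℂ)

theorem iteratedDeriv_eq_taylor (f : ℂ → ℂ) (n : ℕ) :
    iteratedDeriv n f 0 = (n ! : ℂ) * PowerSeries.coeff n (taylor f) := by
  rw [taylor, PowerSeries.coeff_mk, mul_div_cancel₀ _ (Nat.cast_ne_zero.2 n.factorial_ne_zero)]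

theorem taylor_mul {f g : ℂ → ℂ} (hf : AnalyticAt ℂ f 0) (hg : AnalyticAt ℂ g 0) :
    taylor (fun x => f x * g x) = taylor f * taylor g := by
  ext n
  rw [taylor, PowerSeries.coeff_mk, iteratedDeriv_fun_mul hf.contDiffAt hg.contDiffAt,
    PowerSeries.coeff_mul, Finset.Nat.sum_antidiagonal_eq_sum_range_succ_mk, Finset.sum_div]
  refine Finset.sum_congr rfl fun i hi => ?_
  simp only [taylor, PowerSeries.coeff_mk]
  rw [Nat.cast_choose _ (Nat.lt_succ_iff.1 (Finset.mem_range.1 hi))]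
  field_simp [Nat.factorial_ne_zero]

theorem taylor_congr {f g : ℂ → ℂ} (h : f =ᶠ[nhds 0] g) : taylor f = taylor g := by
  ext n
  simp only [taylor, PowerSeries.coeff_mk, h.iteratedDeriv_eq n]

theorem taylor_const (c : ℂ) : taylor (fun _ => c) = PowerSeries.C c := by
  ext n
  rw [taylor, PowerSeries.coeff_mk, iteratedDeriv_const, PowerSeries.coeff_C]
  by_cases h : n = 0 <;> simp [h]

theorem taylor_id : taylor (fun x => x) = PowerSeries.X := by
  ext n
  rw [taylor, PowerSeries.coeff_mk, iteratedDeriv_fun_id_zero, PowerSeries.coeff_X]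
  by_cases h : n = 1 <;> simp [h]

theorem taylor_sub {f g : ℂ → ℂ} (hf : AnalyticAt ℂ f 0) (hg : AnalyticAt ℂ g 0) :
    taylor (fun x => f x - g x) = taylor f - taylor g := by
  ext n
  simp only [taylor, PowerSeries.coeff_mk, map_sub]
  rw [iteratedDeriv_fun_sub hf.contDiffAt hg.contDiffAt, sub_div]

theorem taylor_mul_id {f : ℂ → ℂ} (hf : AnalyticAt ℂ f 0) :
    taylor (fun x => x * f x) = PowerSeries.X * taylor f := by
  rw [taylor_mul (f := fun x => x) analyticAt_id hf, taylor_id]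

theorem taylor_one_sub (a : ℂ) :
    taylor (fun x => 1 - a * x) = 1 - PowerSeries.C a * PowerSeries.X := by
  rw [taylor_sub analyticAt_const (by fun_prop), taylor_mul analyticAt_const (by fun_prop),
    taylor_const, taylor_const, taylor_id, map_one]

section Family

theorem analyticAt_prod_one_sub {ι : Type*} (e : ι → ℂ) (s : Finset ι) :
    AnalyticAt ℂ (fun x => ∏ i ∈ s, (1 - e i * x)) 0 := by
  fun_prop

variable {ι : Type*} [Fintype ι] (e : ι → ℂ)

theorem taylor_prod_one_sub :
    taylor (fun x => ∏ i, (1 - e i * x)) = ∏ i, (1 - PowerSeries.C (e i) * PowerSeries.X) := by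
  classical
  induction (Finset.univ : Finset ι) using Finset.induction_on with
  | empty => simpa using taylor_const 1
  | insert i s hi ih =>
    simp only [Finset.prod_insert hi]
    rw [taylor_mul (by fun_prop) (analyticAt_prod_one_sub e s), ih, taylor_one_sub]

theorem mk_pow_mul_one_sub (a : ℂ) :
    (PowerSeries.mk fun k => a ^ k) * (1 - PowerSeries.C a * PowerSeries.X) = 1 := by
  ext n
  rw [mul_sub, mul_one, mul_comm (PowerSeries.C a), ← mul_assoc, map_sub, PowerSeries.coeff_mul_C]
  cases n with
  | zero => simp
  | succ n => simp [PowerSeries.coeff_succ_mul_X, PowerSeries.coeff_one, pow_succ]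

/-- The series `∏ᵢ 1 / (1 - eᵢ X)`. -/
def homSeries : PowerSeries ℂ := ∏ i, PowerSeries.mk fun k => e i ^ k

theorem analyticAt_inv_prod_one_sub : AnalyticAt ℂ (fun x => (∏ i, (1 - e i * x))⁻¹) 0 :=
  (analyticAt_prod_one_sub e Finset.univ).inv (by simp)

/-- Both sides are inverse to the power series `∏ (1 - e_i X)`: one by geometric series, the other
because the functions multiply to `1` near `0`. -/
theorem taylor_inv_prod_one_sub : taylor (fun x => (∏ i, (1 - e i * x))⁻¹) = homSeries e := by
  have h1 : homSeries e * ∏ i, (1 - PowerSeries.C (e i) * PowerSeries.X) = 1 := by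
    rw [homSeries, ← Finset.prod_mul_distrib]
    exact Finset.prod_eq_one fun i _ => mk_pow_mul_one_sub (e i)
  have h2 : (∏ i, (1 - PowerSeries.C (e i) * PowerSeries.X)) *
      taylor (fun x => (∏ i, (1 - e i * x))⁻¹) = 1 := by
    rw [← taylor_prod_one_sub, ← taylor_mul (analyticAt_prod_one_sub e _)
      (analyticAt_inv_prod_one_sub e), ← map_one PowerSeries.C, ← taylor_const]
    refine taylor_congr ?_
    have hne := (analyticAt_prod_one_sub e Finset.univ).continuousAt.eventually_ne
      (show _ ≠ (0 : ℂ) by simp)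
    filter_upwards [hne] with x hx
    exact mul_inv_cancel₀ hx
  exact (left_inv_eq_right_inv h1 h2).symm

theorem homSymm_zero : homSymm e 0 = 1 := by
  rw [homSymm, PowerSeries.coeff_zero_eq_constantCoeff_apply, map_prod]
  refine Finset.prod_eq_one fun i _ => ?_
  rw [← PowerSeries.coeff_zero_eq_constantCoeff_apply, PowerSeries.coeff_mk, pow_zero]

/-- The logarithmic derivative of `∏ 1 / (1 - e_i X)`; its coefficients give Newton's recursion
between `h_n` and power sums in `succ_mul_homSymm`. -/
theorem derivative_homSeries :
    PowerSeries.derivative ℂ (homSeries e) =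
      homSeries e * ∑ i, PowerSeries.mk fun k => e i ^ (k + 1) := by
  classical
  have h1 : ∀ a : ℂ, PowerSeries.derivative ℂ (PowerSeries.mk fun k => a ^ k) =
      (PowerSeries.mk fun k => a ^ k) * PowerSeries.mk fun k => a ^ (k + 1) := by
    intro a
    ext n
    rw [PowerSeries.coeff_derivative, PowerSeries.coeff_mul, PowerSeries.coeff_mk,
      Finset.sum_congr rfl (g := fun _ => a ^ (n + 1))]
    · simp [mul_comm]
    · intro x hx
      rw [PowerSeries.coeff_mk, PowerSeries.coeff_mk, ← pow_add, ← Finset.HasAntidiagonal.mem_antidiagonal.1 hx,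
        add_assoc]
  unfold homSeries
  induction (Finset.univ : Finset ι) using Finset.induction_on with
  | empty => simp
  | insert i s hi ih =>
    rw [Finset.prod_insert hi, Finset.sum_insert hi, Derivation.leibniz, ih, h1]
    simp only [smul_eq_mul]
    ring

theorem succ_mul_homSymm (n : ℕ) :
    ((n : ℂ) + 1) * homSymm e (n + 1) =
      ∑ x ∈ Finset.HasAntidiagonal.antidiagonal n, homSymm e x.1 * ∑ i, e i ^ (x.2 + 1) := by
  have h := congrArg (PowerSeries.coeff n) (derivative_homSeries e)
  rw [PowerSeries.coeff_derivative, PowerSeries.coeff_mul] at h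
  rw [mul_comm, homSymm]
  refine h.trans (Finset.sum_congr rfl fun x _ => ?_)
  simp [homSymm, homSeries]

theorem homSymm_one : homSymm e 1 = ∑ i, e i := by
  simpa [homSymm_zero] using succ_mul_homSymm e 0

theorem two_mul_homSymm_two : 2 * homSymm e 2 = (∑ i, e i) ^ 2 + ∑ i, e i ^ 2 := by
  have h := succ_mul_homSymm e 1
  rw [Finset.Nat.sum_antidiagonal_eq_sum_range_succ_mk] at h
  norm_num [Finset.sum_range_succ, homSymm_zero, homSymm_one] at h
  rw [h]
  ring

theorem six_mul_homSymm_three : 6 * homSymm e 3 =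
    (∑ i, e i) ^ 3 + 2 * ∑ i, e i ^ 3 + 3 * (∑ i, e i) * ∑ i, e i ^ 2 := by
  have h := succ_mul_homSymm e 2
  have h2 := two_mul_homSymm_two e
  rw [Finset.Nat.sum_antidiagonal_eq_sum_range_succ_mk] at h
  norm_num [Finset.sum_range_succ, homSymm_zero, homSymm_one] at h
  linear_combination 2 * h + (∑ i, e i) * h2

theorem coeff_prod_one_sub (k : ℕ) :
    PowerSeries.coeff k (∏ i, (1 - PowerSeries.C (e i) * PowerSeries.X)) =
      (-1) ^ k * ∑ s ∈ (Finset.univ : Finset ι).powersetCard k, ∏ i ∈ s, e i := by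
  classical
  have h : ∀ s : Finset ι, ∏ i ∈ s, -(PowerSeries.C (e i) * PowerSeries.X) =
      PowerSeries.C ((-1) ^ s.card * ∏ i ∈ s, e i) * PowerSeries.X ^ s.card := by
    intro s
    rw [Finset.prod_neg, Finset.prod_mul_distrib, Finset.prod_const, map_mul, map_prod, map_pow,
      map_neg, map_one, mul_assoc]
  simp only [sub_eq_add_neg, Finset.prod_one_add, h, map_sum, PowerSeries.coeff_C_mul_X_pow]
  rw [Finset.mul_sum, Finset.powersetCard_eq_filter, Finset.sum_filter]
  refine Finset.sum_congr rfl fun s _ => ?_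
  by_cases hs : s.card = k
  · simp [hs]
  · simp [hs, Ne.symm hs]

end Family

variable {d : ℕ} {G : Type*} [Group G] {ρ : Representation ℂ G (Fin d → ℂ)} {g : G}
  {b : Module.Basis (Fin d) ℂ (Fin d → ℂ)} {e : Fin d → ℂ}

/-- With `u = 1/f_g` and `v = 1/f_{g⁻¹}` the function is `u(x) v(y) - (x u(x)) (y v(y))`, so the two
derivatives act on separate factors. -/
theorem molienTerm_eq [Finite G] (h : ∀ i, ρ g (b i) = e i • b i) (p q : ℕ) :
    molienTerm ρ p q g = (p ! : ℂ) * (q ! : ℂ) *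
      (homSymm e p * homSymm (fun i => (e i)⁻¹) q -
        PowerSeries.coeff p (PowerSeries.X * homSeries e) *
          PowerSeries.coeff q (PowerSeries.X * homSeries (fun i => (e i)⁻¹))) := by
  -- Valid for all `x` and `y`, also at zeros of the denominator, since `mul_inv` holds with `0⁻¹ =
  -- 0`.
  have hfun : ∀ x y : ℂ, (1 - x * y) / (detFun ρ g x * detFun ρ g⁻¹ y) =
      (∏ i, (1 - e i * x))⁻¹ * (∏ i, (1 - (e i)⁻¹ * y))⁻¹ -
        (x * (∏ i, (1 - e i * x))⁻¹) * (y * (∏ i, (1 - (e i)⁻¹ * y))⁻¹) := by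
    intro x y
    rw [detFun_eq_prod h, detFun_eq_prod (eigenbasis_inv h), div_eq_mul_inv, mul_inv]
    ring
  have hu := analyticAt_inv_prod_one_sub e
  have hv := analyticAt_inv_prod_one_sub fun i => (e i)⁻¹
  have hxu : AnalyticAt ℂ (fun x => x * (∏ i, (1 - e i * x))⁻¹) 0 := analyticAt_id.mul hu
  have hyv : AnalyticAt ℂ (fun y => y * (∏ i, (1 - (e i)⁻¹ * y))⁻¹) 0 := analyticAt_id.mul hv
  have hT := taylor_inv_prod_one_sub e
  have hT' := taylor_inv_prod_one_sub fun i => (e i)⁻¹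
  have hTx := taylor_mul_id hu
  have hTy := taylor_mul_id hv
  rw [hT] at hTx
  rw [hT'] at hTy
  have hy : ∀ x : ℂ, iteratedDeriv q
      (fun y : ℂ => (1 - x * y) / (detFun ρ g x * detFun ρ g⁻¹ y)) 0 =
      (∏ i, (1 - e i * x))⁻¹ * ((q ! : ℂ) * homSymm (fun i => (e i)⁻¹) q) -
        (x * (∏ i, (1 - e i * x))⁻¹) * ((q ! : ℂ) *
          PowerSeries.coeff q (PowerSeries.X * homSeries (fun i => (e i)⁻¹))) := by
    intro x
    simp only [hfun]
    rw [iteratedDeriv_eq_taylor, taylor_sub (analyticAt_const.fun_mul hv) (analyticAt_const.fun_mul hyv),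
      taylor_mul analyticAt_const hv, taylor_mul analyticAt_const hyv, taylor_const, taylor_const,
      hT', hTy, map_sub, PowerSeries.coeff_C_mul, PowerSeries.coeff_C_mul]
    simp only [homSymm, homSeries]
    ring
  rw [molienTerm]
  simp only [hy]
  rw [iteratedDeriv_eq_taylor, taylor_sub (hu.fun_mul analyticAt_const) (hxu.fun_mul analyticAt_const),
    taylor_mul hu analyticAt_const, taylor_mul hxu analyticAt_const, taylor_const, taylor_const,
    hT, hTx, map_sub, PowerSeries.coeff_mul_C, PowerSeries.coeff_mul_C]
  simp only [homSymm, homSeries]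
  ring

theorem molienTerm_succ_succ [Finite G] (h : ∀ i, ρ g (b i) = e i • b i) (p q : ℕ) :
    molienTerm ρ (p + 1) (q + 1) g = ((p + 1) ! : ℂ) * ((q + 1) ! : ℂ) *
      (homSymm e (p + 1) * homSymm (fun i => (e i)⁻¹) (q + 1) -
        homSymm e p * homSymm (fun i => (e i)⁻¹) q) := by
  rw [molienTerm_eq h, PowerSeries.coeff_succ_X_mul, PowerSeries.coeff_succ_X_mul]
  rfl

theorem molienTerm_zero_left [Finite G] (h : ∀ i, ρ g (b i) = e i • b i) (q : ℕ) :
    molienTerm ρ 0 q g = (0 ! : ℂ) * (q ! : ℂ) * (homSymm e 0 * homSymm (fun i => (e i)⁻¹) q) := by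
  rw [molienTerm_eq h, PowerSeries.coeff_zero_X_mul, zero_mul, sub_zero]

theorem molienTerm_zero_right [Finite G] (h : ∀ i, ρ g (b i) = e i • b i) (p : ℕ) :
    molienTerm ρ p 0 g = (p ! : ℂ) * (0 ! : ℂ) * (homSymm e p * homSymm (fun i => (e i)⁻¹) 0) := by
  rw [molienTerm_eq h, PowerSeries.coeff_zero_X_mul, mul_zero, sub_zero]

/-- Passing to `g⁻¹` exchanges `e` and `e⁻¹`; summed over `G` this gives the symmetry in `p` and
`q`. -/
theorem molienTerm_inv [Finite G] (ρ : Representation ℂ G (Fin d → ℂ)) (p q : ℕ) (g : G) :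
    molienTerm ρ q p g⁻¹ = molienTerm ρ p q g := by
  obtain ⟨b, e, h⟩ := exists_eigenbasis ρ g
  rw [molienTerm_eq h, molienTerm_eq (eigenbasis_inv h)]
  simp only [inv_inv]
  ring

theorem molienTerm_one_zero [Finite G] (ρ : Representation ℂ G (Fin d → ℂ)) (g : G) :
    molienTerm ρ 1 0 g = term10 ρ g := by
  obtain ⟨b, e, h⟩ := exists_eigenbasis ρ g
  rw [molienTerm_zero_right h, term10, tr_eq_sum h, homSymm_one, homSymm_zero]
  simp

theorem molienTerm_two_zero [Finite G] (ρ : Representation ℂ G (Fin d → ℂ)) (g : G) :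
    molienTerm ρ 2 0 g = term20 ρ g := by
  obtain ⟨b, e, h⟩ := exists_eigenbasis ρ g
  rw [molienTerm_zero_right h, term20, tr_eq_sum h, tr_eq_sum (eigenbasis_pow h 2), homSymm_zero,
    ← two_mul_homSymm_two]
  simp

theorem molienTerm_three_zero [Finite G] (ρ : Representation ℂ G (Fin d → ℂ)) (g : G) :
    molienTerm ρ 3 0 g = term30 ρ g := by
  obtain ⟨b, e, h⟩ := exists_eigenbasis ρ g
  rw [molienTerm_zero_right h, term30, tr_eq_sum h, tr_eq_sum (eigenbasis_pow h 2),
    tr_eq_sum (eigenbasis_pow h 3), homSymm_zero, ← six_mul_homSymm_three]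
  simp [Nat.factorial]

theorem molienTerm_one_one [Finite G] (ρ : Representation ℂ G (Fin d → ℂ)) (g : G) :
    molienTerm ρ 1 1 g = term11 ρ g := by
  obtain ⟨b, e, h⟩ := exists_eigenbasis ρ g
  rw [molienTerm_succ_succ h 0 0, term11, tr_eq_sum h, tr_eq_sum (eigenbasis_inv h)]
  simp [homSymm_zero, homSymm_one]

theorem molienTerm_two_one [Finite G] (ρ : Representation ℂ G (Fin d → ℂ)) (g : G) :
    molienTerm ρ 2 1 g = term21 ρ g := by
  obtain ⟨b, e, h⟩ := exists_eigenbasis ρ g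
  rw [molienTerm_succ_succ h 1 0, term21, tr_eq_sum h, tr_eq_sum (eigenbasis_inv h),
    tr_eq_sum (eigenbasis_pow h 2)]
  have h2 := two_mul_homSymm_two e
  simp only [zero_add, homSymm_one, homSymm_zero, Nat.factorial_one, Nat.cast_one, mul_one]
  norm_num
  linear_combination (∑ i, (e i)⁻¹) * h2

/-- Wedges of distinct eigenvectors form an eigenbasis of the exterior power. -/
theorem trExt_eq_sum (h : ∀ i, ρ g (b i) = e i • b i) (k : ℕ) :
    trExt ρ k g = ∑ s ∈ (Finset.univ : Finset (Fin d)).powersetCard k, ∏ i ∈ s, e i := by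
  rw [trExt, trace_eq_sum_of_eigenbasis (b.exteriorPower k) _ (fun s => ∏ i ∈ s.1, e i)]
  · exact (Finset.sum_subtype _ (by simp [Set.powersetCard]) fun s => ∏ i ∈ s, e i).symm
  · intro s
    rw [exteriorPower.basis_apply, exteriorPower.map_apply_ιMulti_family,
      exteriorPower.ιMulti_family, exteriorPower.ιMulti_family]
    have hcomp : ((ρ g) ∘ b) ∘ Set.powersetCard.ofFinEmbEquiv.symm s =
        fun j => e (Set.powersetCard.ofFinEmbEquiv.symm s j) •
          (b ∘ Set.powersetCard.ofFinEmbEquiv.symm s) j := by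
      funext j
      exact h _
    rw [hcomp]
    refine ((exteriorPower.ιMulti ℂ k).toMultilinearMap.map_smul_univ _ _).trans ?_
    congr 1
    exact (Fintype.prod_equiv (Set.powersetCard.orderIsoOfFin s).toEquiv _
      (fun i : s.1 => e i.1) fun _ => rfl).trans (Finset.prod_coe_sort s.1 e)

theorem iteratedDeriv_detFun (h : ∀ i, ρ g (b i) = e i • b i) (k : ℕ) :
    iteratedDeriv k (detFun ρ g) 0 = (-1) ^ k * (k ! : ℂ) * trExt ρ k g := by
  have hfun : detFun ρ g = fun x => ∏ i, (1 - e i * x) := funext (detFun_eq_prod h)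
  rw [hfun, iteratedDeriv_eq_taylor, taylor_prod_one_sub, coeff_prod_one_sub, trExt_eq_sum h]
  ring

theorem trExt_eq_zero (h : ∀ i, ρ g (b i) = e i • b i) {k : ℕ} (hk : d < k) :
    trExt ρ k g = 0 := by
  rw [trExt_eq_sum h, Finset.powersetCard_eq_empty.2 (by simpa using hk), Finset.sum_empty]

theorem trExt_zero (h : ∀ i, ρ g (b i) = e i • b i) : trExt ρ 0 g = 1 := by
  simp [trExt_eq_sum h]

end

/-! ### Invariant harmonics: dimension count, symmetry and conjugacy classes. -/

section

variable {d : ℕ} {G : Type*} [Group G]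

theorem star_dotProduct_mulVec_mulVec (A M : Matrix (Fin d) (Fin d) ℂ) (v w : Fin d → ℂ) :
    star (M.mulVec v) ⬝ᵥ A.mulVec (M.mulVec w) =
      star v ⬝ᵥ (M.conjTranspose * A * M).mulVec w := by
  rw [Matrix.star_mulVec, ← Matrix.dotProduct_mulVec, Matrix.mulVec_mulVec, Matrix.mulVec_mulVec,
    mul_assoc]

theorem invariantInner_iff (ρ : Representation ℂ G (Fin d → ℂ)) (A : Matrix (Fin d) (Fin d) ℂ) :
    InvariantInner ρ A ↔ A.PosDef ∧ ∀ g, (mat ρ g).conjTranspose * A * mat ρ g = A := by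
  refine and_congr Iff.rfl (forall_congr' fun g => ?_)
  simp only [← mat_mulVec, star_dotProduct_mulVec_mulVec]
  refine ⟨fun h => ?_, fun h v w => by rw [h]⟩
  ext i j
  have hij := h (Pi.single i 1) (Pi.single j 1)
  simpa [← Pi.single_star] using hij

theorem exists_invariantInner [Fintype G] (ρ : Representation ℂ G (Fin d → ℂ)) :
    ∃ A : Matrix (Fin d) (Fin d) ℂ, InvariantInner ρ A := by
  classical
  refine ⟨∑ g, (mat ρ g).conjTranspose * mat ρ g, (invariantInner_iff ρ _).2 ⟨?_, fun h => ?_⟩⟩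
  -- The term of the identity is positive definite; the others need only be semidefinite.
  · rw [← Finset.add_sum_erase _ _ (Finset.mem_univ (1 : G)), mat_one, Matrix.conjTranspose_one,
      one_mul]
    exact Matrix.PosDef.one.add_posSemidef
      (Matrix.posSemidef_sum _ fun g _ => Matrix.posSemidef_conjTranspose_mul_self _)
  · rw [Finset.mul_sum, Finset.sum_mul, ← Equiv.sum_comp (Equiv.mulRight h)
      fun g => (mat ρ g).conjTranspose * mat ρ g]
    refine Finset.sum_congr rfl fun g _ => ?_
    simp only [Equiv.coe_mulRight, mat_mul, Matrix.conjTranspose_mul, mul_assoc]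

/-- The invariant polynomials of bidegree `(p,q)`. -/
def invPoly (ρ : Representation ℂ G (Fin d → ℂ)) (p q : ℕ) : Submodule ℂ (BiPoly d) :=
  biHom d p q ⊓ (polyRep ρ).invariants

instance (ρ : Representation ℂ G (Fin d → ℂ)) (p q : ℕ) : FiniteDimensional ℂ (invPoly ρ p q) :=
  Submodule.finiteDimensional_inf_left _ _

/-- Injectivity of `toFun` lifts invariance from functions to polynomials. -/
theorem fixedBy_harm_eq_map (ρ : Representation ℂ G (Fin d → ℂ)) (A : Matrix (Fin d) (Fin d) ℂ)
    (p q : ℕ) :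
    fixedBy ρ (harm A p q) = (invPoly ρ p q ⊓ LinearMap.ker (laplacian A)).map (toFun d) := by
  ext f
  constructor
  · rintro ⟨⟨P, ⟨hP, hΔ⟩, rfl⟩, hf⟩
    refine ⟨P, ⟨⟨hP, fun g => toFun_injective d ?_⟩, hΔ⟩, rfl⟩
    rw [toFun_polyRep]
    exact hf g
  · rintro ⟨P, ⟨⟨hP, hinv⟩, hΔ⟩, rfl⟩
    refine ⟨⟨P, ⟨hP, hΔ⟩, rfl⟩, fun g => ?_⟩
    rw [← toFun_polyRep, hinv g]

theorem finite_fixedBy_harm (ρ : Representation ℂ G (Fin d → ℂ)) (A : Matrix (Fin d) (Fin d) ℂ)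
    (p q : ℕ) : Module.Finite ℂ (fixedBy ρ (harm A p q)) := by
  rw [fixedBy_harm_eq_map]
  have := Submodule.finiteDimensional_inf_left (invPoly ρ p q) (LinearMap.ker (laplacian A))
  infer_instance

theorem dimHarm_eq_finrank (ρ : Representation ℂ G (Fin d → ℂ)) (A : Matrix (Fin d) (Fin d) ℂ)
    (p q : ℕ) : dimHarm ρ A p q =
      Module.finrank ℂ (invPoly ρ p q ⊓ LinearMap.ker (laplacian A) : Submodule ℂ (BiPoly d)) := by
  rw [dimHarm, fixedBy_harm_eq_map]
  exact (Submodule.equivMapOfInjective _ (toFun_injective d) _).finrank_eq.symm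

theorem finrank_invPoly_eq_finrank_invariants (ρ : Representation ℂ G (Fin d → ℂ)) (p q : ℕ) :
    Module.finrank ℂ (invPoly ρ p q) = Module.finrank ℂ (biHomRep ρ p q).invariants := by
  rw [← Submodule.finrank_map_subtype_eq (biHom d p q) (biHomRep ρ p q).invariants]
  congr 2
  all_goals
    ext P
    constructor
    · rintro ⟨hP, hinv⟩
      exact ⟨⟨P, hP⟩, fun g => Subtype.ext (hinv g), rfl⟩
    · rintro ⟨⟨P, hP⟩, hinv, rfl⟩
      exact ⟨hP, fun g => congrArg Subtype.val (hinv g)⟩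

theorem finrank_invPoly [Fintype G] (ρ : Representation ℂ G (Fin d → ℂ)) (p q : ℕ) :
    (Module.finrank ℂ (invPoly ρ p q) : ℂ) =
      1 / (Fintype.card G : ℂ) * ∑ g : G, LinearMap.trace ℂ _ (biHomRep ρ p q g⁻¹) := by
  rw [finrank_invPoly_eq_finrank_invariants, finrank_invariants_eq,
    ← Equiv.sum_comp (Equiv.inv G)]
  rfl

theorem laplacian_polyRep {ρ : Representation ℂ G (Fin d → ℂ)} {A : Matrix (Fin d) (Fin d) ℂ}
    (hA : InvariantInner ρ A) (g : G) (P : BiPoly d) :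
    laplacian A (polyRep ρ g P) = polyRep ρ g (laplacian A P) :=
  laplacian_linSubst hA.1.det_pos.ne'.isUnit (((invariantInner_iff ρ A).1 hA).2 g⁻¹) P

/-- Averaging over `G` commutes with the Laplacian and fixes `Q`, so the average of any preimage of
`Q` is an invariant preimage. -/
theorem map_laplacian_invPoly [Finite G] (hd : 1 ≤ d) {ρ : Representation ℂ G (Fin d → ℂ)}
    {A : Matrix (Fin d) (Fin d) ℂ} (hA : InvariantInner ρ A) (p q : ℕ) :
    (invPoly ρ (p + 1) (q + 1)).map (laplacian A) = invPoly ρ p q := by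
  refine le_antisymm (Submodule.map_le_iff_le_comap.2 fun P hP => ⟨laplacian_mem_biHom A hP.1,
    fun g => ?_⟩) fun Q hQ => ?_
  · rw [← laplacian_polyRep hA, hP.2 g]
  · have := Fintype.ofFinite G
    have : Invertible (Fintype.card G : ℂ) :=
      invertibleOfNonzero (Nat.cast_ne_zero.2 Fintype.card_ne_zero)
    -- Here `1 ≤ d` supplies an index, and diagonal entries of the positive definite `A⁻¹` are
    -- positive.
    have ho : A⁻¹ (⟨0, hd⟩ : Fin d) ⟨0, hd⟩ ≠ 0 := hA.1.inv.diag_pos.ne'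
    obtain ⟨P, hP, hPQ⟩ := (map_laplacian_biHom ho p q).ge hQ.1
    have havg : ∀ R, (polyRep ρ).averageMap R = ⅟(Fintype.card G : ℂ) • ∑ g, polyRep ρ g R := by
      intro R
      simp [Representation.averageMap, GroupAlgebra.average, map_sum,
        Representation.asAlgebraHom_single]
    refine ⟨(polyRep ρ).averageMap P, ⟨?_, (polyRep ρ).averageMap_invariant P⟩, ?_⟩
    · rw [havg]
      exact Submodule.smul_mem _ _ (Submodule.sum_mem _ fun g _ =>
        linSubst_conjBlock_mem_biHom _ hP)
    · rw [havg, map_smul, map_sum]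
      simp only [laplacian_polyRep hA, hPQ]
      rw [← havg]
      exact (polyRep ρ).averageMap_id Q hQ.2

theorem finrank_map_add_finrank_inf_ker {V W : Type*} [AddCommGroup V] [Module ℂ V]
    [AddCommGroup W] [Module ℂ W] (U : Submodule ℂ V) [FiniteDimensional ℂ U] (f : V →ₗ[ℂ] W) :
    Module.finrank ℂ (U.map f) +
      Module.finrank ℂ (U ⊓ LinearMap.ker f : Submodule ℂ V) = Module.finrank ℂ U := by
  rw [← LinearMap.finrank_range_add_finrank_ker (f.domRestrict U), LinearMap.range_domRestrict,
    LinearMap.ker_domRestrict, ← Submodule.finrank_map_subtype_eq U, Submodule.map_comap_subtype]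

theorem dimHarm_succ_succ [Finite G] (hd : 1 ≤ d) {ρ : Representation ℂ G (Fin d → ℂ)}
    {A : Matrix (Fin d) (Fin d) ℂ} (hA : InvariantInner ρ A) (p q : ℕ) :
    Module.finrank ℂ (invPoly ρ p q) + dimHarm ρ A (p + 1) (q + 1) =
      Module.finrank ℂ (invPoly ρ (p + 1) (q + 1)) := by
  rw [dimHarm_eq_finrank, ← map_laplacian_invPoly hd hA]
  exact finrank_map_add_finrank_inf_ker _ _

theorem dimHarm_zero_left (ρ : Representation ℂ G (Fin d → ℂ)) (A : Matrix (Fin d) (Fin d) ℂ)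
    (q : ℕ) : dimHarm ρ A 0 q = Module.finrank ℂ (invPoly ρ 0 q) := by
  rw [dimHarm_eq_finrank, inf_eq_left.2]
  exact fun P hP => laplacian_eq_zero_of_zero_left A hP.1

theorem dimHarm_zero_right (ρ : Representation ℂ G (Fin d → ℂ)) (A : Matrix (Fin d) (Fin d) ℂ)
    (p : ℕ) : dimHarm ρ A p 0 = Module.finrank ℂ (invPoly ρ p 0) := by
  rw [dimHarm_eq_finrank, inf_eq_left.2]
  exact fun P hP => laplacian_eq_zero_of_zero_right A hP.1

theorem molienTerm_succ_succ_eq_trace [Finite G] (ρ : Representation ℂ G (Fin d → ℂ)) (p q : ℕ)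
    (g : G) :
    molienTerm ρ (p + 1) (q + 1) g = ((p + 1) ! : ℂ) * ((q + 1) ! : ℂ) *
      (LinearMap.trace ℂ _ (biHomRep ρ (p + 1) (q + 1) g⁻¹) -
        LinearMap.trace ℂ _ (biHomRep ρ p q g⁻¹)) := by
  obtain ⟨b, e, h⟩ := exists_eigenbasis ρ g
  rw [molienTerm_succ_succ h, trace_biHomRep_inv h, trace_biHomRep_inv h]

theorem molienTerm_zero_left_eq_trace [Finite G] (ρ : Representation ℂ G (Fin d → ℂ)) (q : ℕ)
    (g : G) :
    molienTerm ρ 0 q g =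
      (0 ! : ℂ) * (q ! : ℂ) * LinearMap.trace ℂ _ (biHomRep ρ 0 q g⁻¹) := by
  obtain ⟨b, e, h⟩ := exists_eigenbasis ρ g
  rw [molienTerm_zero_left h, trace_biHomRep_inv h]

theorem molienTerm_zero_right_eq_trace [Finite G] (ρ : Representation ℂ G (Fin d → ℂ)) (p : ℕ)
    (g : G) :
    molienTerm ρ p 0 g =
      (p ! : ℂ) * (0 ! : ℂ) * LinearMap.trace ℂ _ (biHomRep ρ p 0 g⁻¹) := by
  obtain ⟨b, e, h⟩ := exists_eigenbasis ρ g
  rw [molienTerm_zero_right h, trace_biHomRep_inv h]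

/-- Molien's formula for the dimension of the invariant harmonic polynomials. -/
theorem dimHarm_eq_sum_molienTerm [Fintype G] (hd : 1 ≤ d) {ρ : Representation ℂ G (Fin d → ℂ)}
    {A : Matrix (Fin d) (Fin d) ℂ} (hA : InvariantInner ρ A) (p q : ℕ) :
    (dimHarm ρ A p q : ℂ) =
      1 / ((p ! : ℂ) * (q ! : ℂ)) * (1 / (Fintype.card G : ℂ)) * ∑ g : G, molienTerm ρ p q g := by
  have hfac : ((p ! : ℂ) * (q ! : ℂ)) ≠ 0 := mul_ne_zero
    (Nat.cast_ne_zero.2 p.factorial_ne_zero) (Nat.cast_ne_zero.2 q.factorial_ne_zero)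
  have key : ∀ T : ℂ, 1 / ((p ! : ℂ) * (q ! : ℂ)) * (1 / (Fintype.card G : ℂ)) *
      ((p ! : ℂ) * (q ! : ℂ) * T) = 1 / (Fintype.card G : ℂ) * T := by
    intro T
    field_simp
  rcases p with _ | p
  · simp only [molienTerm_zero_left_eq_trace, ← Finset.mul_sum]
    rw [key, dimHarm_zero_left, finrank_invPoly]
  rcases q with _ | q
  · simp only [molienTerm_zero_right_eq_trace, ← Finset.mul_sum]
    rw [key, dimHarm_zero_right, finrank_invPoly]
  simp only [molienTerm_succ_succ_eq_trace, ← Finset.mul_sum]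
  have h := congrArg (Nat.cast : ℕ → ℂ) (dimHarm_succ_succ hd hA p q)
  rw [Nat.cast_add, finrank_invPoly, finrank_invPoly] at h
  rw [key, Finset.sum_sub_distrib]
  linear_combination h

theorem dimHarm_comm [Fintype G] (hd : 1 ≤ d) {ρ : Representation ℂ G (Fin d → ℂ)}
    {A : Matrix (Fin d) (Fin d) ℂ} (hA : InvariantInner ρ A) (p q : ℕ) :
    dimHarm ρ A p q = dimHarm ρ A q p := by
  apply Nat.cast_injective (R := ℂ)
  rw [dimHarm_eq_sum_molienTerm hd hA, dimHarm_eq_sum_molienTerm hd hA,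
    ← Equiv.sum_comp (Equiv.inv G) (molienTerm ρ q p)]
  simp only [Equiv.inv_apply, molienTerm_inv]
  rw [mul_comm (p ! : ℂ)]

/-- `f_g` and `f_{g⁻¹}` are both products over the multiset of eigenvalues of `g`. -/
theorem molienTerm_eq_of_roots_eq [Finite G] (ρ : Representation ℂ G (Fin d → ℂ)) (p q : ℕ)
    {g h : G} (hgh : (ρ g).charpoly.roots = (ρ h).charpoly.roots) :
    molienTerm ρ p q g = molienTerm ρ p q h := by
  obtain ⟨b, e, hb⟩ := exists_eigenbasis ρ g
  obtain ⟨b', e', hb'⟩ := exists_eigenbasis ρ h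
  rw [roots_charpoly_eq hb, roots_charpoly_eq hb'] at hgh
  have hprod : ∀ F : ℂ → ℂ, ∏ i, F (e i) = ∏ i, F (e' i) := by
    intro F
    have := congrArg (fun s => (s.map F).prod) hgh
    rw [Multiset.map_map, Multiset.map_map] at this
    exact this
  have h1 : detFun ρ g = detFun ρ h := by
    funext x
    rw [detFun_eq_prod hb, detFun_eq_prod hb']
    exact hprod fun a => 1 - a * x
  have h2 : detFun ρ g⁻¹ = detFun ρ h⁻¹ := by
    funext x
    rw [detFun_eq_prod (eigenbasis_inv hb), detFun_eq_prod (eigenbasis_inv hb')]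
    exact hprod fun a => 1 - a⁻¹ * x
  rw [molienTerm, molienTerm, h1, h2]

/-- Reduces the explicit trace summands to Molien terms, so the claims on eigenvalues and classes
need only one proof. -/
theorem IsSummand.exists_eq_molienTerm [Finite G] {ρ : Representation ℂ G (Fin d → ℂ)}
    {t : G → ℂ} (ht : IsSummand ρ t) : ∃ p q, t = molienTerm ρ p q := by
  rcases ht with h | h | h | h | h | h
  · exact h
  · exact ⟨1, 0, h.trans (funext fun g => (molienTerm_one_zero ρ g).symm)⟩
  · exact ⟨2, 0, h.trans (funext fun g => (molienTerm_two_zero ρ g).symm)⟩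
  · exact ⟨3, 0, h.trans (funext fun g => (molienTerm_three_zero ρ g).symm)⟩
  · exact ⟨1, 1, h.trans (funext fun g => (molienTerm_one_one ρ g).symm)⟩
  · exact ⟨2, 1, h.trans (funext fun g => (molienTerm_two_one ρ g).symm)⟩

theorem charpoly_eq_of_isConj (ρ : Representation ℂ G (Fin d → ℂ)) {g h : G} (hgh : IsConj g h) :
    (ρ g).charpoly = (ρ h).charpoly := by
  obtain ⟨c, rfl⟩ := isConj_iff.1 hgh
  have hmat : ∀ x : G, (ρ x).charpoly = (mat ρ x).charpoly := fun x =>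
    (LinearMap.charpoly_toMatrix (ρ x) (Pi.basisFun ℂ (Fin d))).symm
  rw [hmat, hmat, mul_assoc, mat_mul, Matrix.charpoly_mul_comm, ← mat_mul, inv_mul_cancel_right]

theorem sum_eq_sum_conjClasses [Fintype G] [Fintype (ConjClasses G)] {t : G → ℂ}
    (ht : ∀ g h, IsConj g h → t g = t h) (s : ConjClasses G → G)
    (hs : ∀ C, ConjClasses.mk (s C) = C) :
    ∑ g : G, t g = ∑ C : ConjClasses G, (C.carrier.ncard : ℂ) * t (s C) := by
  classical
  rw [← Finset.sum_fiberwise Finset.univ ConjClasses.mk t]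
  refine Finset.sum_congr rfl fun C _ => ?_
  have hcarrier : C.carrier = ↑(Finset.univ.filter fun g => ConjClasses.mk g = C) := by
    ext g
    simp [ConjClasses.mem_carrier_iff_mk_eq]
  rw [hcarrier, Set.ncard_coe_finset, ← nsmul_eq_mul]
  refine Finset.sum_eq_card_nsmul fun g hg => ht _ _ ?_
  rw [← ConjClasses.mk_eq_mk_iff_isConj, hs]
  exact (Finset.mem_filter.1 hg).2

end

end

end HarmonicMolien
open HarmonicMolien in
theorem proposition3p1 {d : ℕ} (hd : 1 ≤ d) {G : Type*} [Group G] [Fintype G]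
    [Fintype (ConjClasses G)] (ρ : Representation ℂ G (Fin d → ℂ)) :
    -- an invariant inner product exists
    (∃ A : Matrix (Fin d) (Fin d) ℂ, InvariantInner ρ A) ∧
    -- the dimension formulas, for `H(p,q)` formed with any invariant inner product
    (∀ A : Matrix (Fin d) (Fin d) ℂ, InvariantInner ρ A →
      (∀ p q : ℕ,
        Module.Finite ℂ (fixedBy ρ (harm A p q)) ∧
        dimHarm ρ A p q = dimHarm ρ A q p ∧
        (dimHarm ρ A p q : ℂ) =
          1 / ((p ! : ℂ) * (q ! : ℂ)) * (1 / (Fintype.card G : ℂ)) * ∑ g : G, molienTerm ρ p q g) ∧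
      (dimHarm ρ A 1 0 : ℂ) = 1 / (Fintype.card G : ℂ) * ∑ g : G, term10 ρ g ∧
      (dimHarm ρ A 2 0 : ℂ) = 1 / 2 * (1 / (Fintype.card G : ℂ)) * ∑ g : G, term20 ρ g ∧
      (dimHarm ρ A 3 0 : ℂ) = 1 / 6 * (1 / (Fintype.card G : ℂ)) * ∑ g : G, term30 ρ g ∧
      (dimHarm ρ A 1 1 : ℂ) = 1 / (Fintype.card G : ℂ) * ∑ g : G, term11 ρ g ∧
      (dimHarm ρ A 2 1 : ℂ) = 1 / 2 * (1 / (Fintype.card G : ℂ)) * ∑ g : G, term21 ρ g) ∧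
    -- the derivatives of `f_g` at `0`
    (∀ (g : G) (k : ℕ),
      iteratedDeriv k (detFun ρ g) 0 =
        if k = 0 then 1
        else if k ≤ d then (-1) ^ k * (k ! : ℂ) * trExt ρ k g
        else 0) ∧
    -- each summand depends only on the eigenvalues (with multiplicity) of `g`, and the sums over
    -- `G` can be taken over conjugacy classes
    (∀ t : G → ℂ, IsSummand ρ t →
      (∀ g h : G, (ρ g).charpoly.roots = (ρ h).charpoly.roots → t g = t h) ∧
      ∀ s : ConjClasses G → G, (∀ C, ConjClasses.mk (s C) = C) →
        ∑ g : G, t g = ∑ C : ConjClasses G, (C.carrier.ncard : ℂ) * t (s C)) := by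
  refine ⟨exists_invariantInner ρ, fun A hA => ?_, fun g k => ?_, fun t ht => ?_⟩
  · have hdim := dimHarm_eq_sum_molienTerm hd hA
    refine ⟨fun p q => ⟨finite_fixedBy_harm ρ A p q, dimHarm_comm hd hA p q, hdim p q⟩,
      ?_, ?_, ?_, ?_, ?_⟩
    · rw [hdim]
      simp [molienTerm_one_zero]
    · rw [hdim]
      simp [molienTerm_two_zero]
    · rw [hdim]
      simp [molienTerm_three_zero, Nat.factorial]
    · rw [hdim]
      simp [molienTerm_one_one]
    · rw [hdim]
      simp [molienTerm_two_one]
  · obtain ⟨b, e, h⟩ := exists_eigenbasis ρ g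
    -- The exterior power formula holds for every `k`; the outer cases are `tr(Λ^0 g) = 1` and `Λ^k
    -- = 0` for `k > d`.
    rw [iteratedDeriv_detFun h]
    split_ifs with h0 hk
    · simp [h0, trExt_zero h]
    · rfl
    · rw [trExt_eq_zero h (not_le.1 hk), mul_zero]
  · obtain ⟨p, q, rfl⟩ := ht.exists_eq_molienTerm
    exact ⟨fun g h hgh => molienTerm_eq_of_roots_eq ρ p q hgh, sum_eq_sum_conjClasses
      fun g h hgh => molienTerm_eq_of_roots_eq ρ p q (by rw [charpoly_eq_of_isConj ρ hgh])⟩
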